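/- Let $n\ge 0$ and $p\ge 1$ be integers. Let $G=q(n+1)$ be the complex Lie superalgebra with even basis elements $e_{ij}^{0}$ and odd basis elements $e_{ij}^{1}$ ($0\le i,j\le n$) and bracket $[\![e_{ij}^\sigma,e_{kl}^\theta]\!]=\delta_{jk}e_{il}^{\sigma+\theta}-(-1)^{\sigma\theta}\delta_{il}e_{kj}^{\sigma+\theta}$, and put $b_i^+=e_{i0}^0$, $f_i^+=e_{i0}^1$ for $1\le i\le n$. $G$-modules are not required to be graded. Let $\bar V_p=\mathrm{Ind}\,\mathbb C v_0$ be the $G$-module induced from the one-dimensional module $\mathbb Cv_0$ of the subalgebra spanned by all $e_{00}^\sigma$, $e_{ij}^\sigma$, $e_{0i}^\sigma$ ($i,j\ge1$), on which $e_{00}^0v_0=p\,v_0$, $e_{00}^1v_0=\sqrt p\,v_0$, and all $e_{ij}^\sigma$, $e_{0i}^\sigma$ ($i,j\ge 1$) act by $0$. For a $G$-module $V$ and $\mu\in\mathbb C^{n+1}$ write $V(\mu)=\{v: e_{ii}^0v=\mu_iv,\ 0\le i\le n\}$. For $m\in\mathbb Z_{\ge0}^n$ put $\lambda_m=(p-\sum_i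 m_i,m_1,\dots,m_n)$; its level, and the level of any nonzero $v\in\bar V_p(\lambda_m)$, is $\sum_i m_i$; let $r(m)$ be the number of nonzero $m_i$ and $d_m=\dim\bar V_p(\lambda_m)$. For $k\in\mathbb Z_{\ge0}^n$, $l\in\{0,1\}^n$ put $|p;k,l\rangle=(b_1^+)^{k_1}(f_1^+)^{l_1}\cdots(b_n^+)^{k_n}(f_n^+)^{l_n}v_0$ and $$X(p;k,l)=(-1)^{l_1+\cdots+l_n}\sqrt p\,|p;k,l\rangle-\sum_{i=1}^n(-1)^{l_1+\cdots+l_i}l_i\,|k_i+1,l_i-1\rangle-\sum_{i=1}^n(-1)^{l_1+\cdots+l_i}\delta_{l_i,0}k_i\,|k_i-1,l_i+1\rangle,$$ where only the changed labels are displayed. The weights of $\bar V_p$ are exactly the $\lambda_m$, with $d_m=2^{r(m)}$; $\bar V_p$ has a largest submodule $M_p\ne\bar V_p$, and $M_p$ is the sum of its weight spaces $M_p(\lambda_m)=M_p\cap\bar V_p(\lambda_m)$. Let $V_p=\bar V_p/M_p$. Then the weight vectors $v$ of $\bar V_p$ satisfy: (a) if the level of $v$ is greater than $p$, then $v\in M_p$;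 (b) if the level of $v$ is less than $p$, then $v\notin M_p$; (c) if $\lambda_m$ has level $p$, then $\dim M_p(\lambda_m)=\dim V_p(\lambda_m)=d_m/2$, and the vectors $X(p;k,l)$ with $k_i+l_i=m_i$ for all $i$ span $M_p(\lambda_m)$. Consequently $V_p$ is finite-dimensional and is the sum of its weight spaces; $\dim V_p(\lambda_m)$ equals $2^{r(m)}$ if the level of $\lambda_m$ is less than $p$, $2^{r(m)-1}$ if the level is $p$, and $0$ if the level is greater than $p$; and $V_p$ has no other weights. -/

import Mathlib

noncomputable section

namespace QFock

/-- The Lie superalgebra `q(n+1)`. An element is a pair `(x 0, x 1)` of complex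
`(n+1) × (n+1)` matrices, standing for the block matrix `(A B; B A)` with `A = x 0` (the even
part) and `B = x 1` (the odd part). Matrix indices run over `0, 1, …, n`. -/
abbrev Q (n : ℕ) : Type := ZMod 2 → Matrix (Fin (n + 1)) (Fin (n + 1)) ℂ

/-- The block matrix `(A B; B A)` of an element of `q(n+1)`. -/
def toBlocks {n : ℕ} (x : Q n) :
    Matrix (Fin (n + 1) ⊕ Fin (n + 1)) (Fin (n + 1) ⊕ Fin (n + 1)) ℂ :=
  Matrix.fromBlocks (x 0) (x 1) (x 1) (x 0)

/-- The homogeneous element of parity `σ` given by a matrix. -/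
abbrev hom {n : ℕ} (σ : ZMod 2) (A : Matrix (Fin (n + 1)) (Fin (n + 1)) ℂ) : Q n :=
  Pi.single σ A

/-- The sign `(-1)^(σθ)`. -/
def sgn (σ θ : ZMod 2) : ℂ := (-1) ^ (σ.val * θ.val)

/-- The Lie superbracket of `q(n+1)`: the bilinear extension of the supercommutator
`x y - (-1)^(σθ) y x` of homogeneous elements of parities `σ` and `θ`. -/
def bracket {n : ℕ} (x y : Q n) : Q n :=
  ∑ σ : ZMod 2, ∑ θ : ZMod 2, hom (σ + θ) (x σ * y θ - sgn σ θ • (y θ * x σ))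

/-- On homogeneous elements the bracket is the supercommutator of the block matrices. -/
theorem toBlocks_bracket {n : ℕ} (σ θ : ZMod 2) (A B : Matrix (Fin (n + 1)) (Fin (n + 1)) ℂ) :
    toBlocks (bracket (hom σ A) (hom θ B)) =
      toBlocks (hom σ A) * toBlocks (hom θ B) -
        sgn σ θ • (toBlocks (hom θ B) * toBlocks (hom σ A)) := by
  have hsum : ∀ f : ZMod 2 → Q n, ∑ x, f x = f 0 + f 1 := fun f => Fin.sum_univ_two f
  have h10 : (1 : ZMod 2) ≠ 0 := by decide
  have h11 : (1 : ZMod 2) + 1 = 0 := by decide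
  have hv : (1 : ZMod 2).val = 1 := rfl
  have key : ∀ τ : ZMod 2, τ = 0 ∨ τ = 1 := by decide
  simp only [bracket, hsum]
  rcases key σ with rfl | rfl <;> rcases key θ with rfl | rfl <;>
    simp [toBlocks, h10, h10.symm, h11, hv, Matrix.fromBlocks_multiply,
      Matrix.fromBlocks_neg, sgn, sub_eq_add_neg, Matrix.fromBlocks_add]

/-- The basis element `e_{ij}^σ`. -/
def e (n : ℕ) (σ : ZMod 2) (i j : Fin (n + 1)) : Q n := hom σ (Matrix.single i j 1)

/-- The defining relations of the enveloping algebra: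
`x y - (-1)^(σθ) y x = ⟦x, y⟧` for homogeneous `x`, `y` of parities `σ`, `θ`. -/
inductive EnvRel (n : ℕ) : TensorAlgebra ℂ (Q n) → TensorAlgebra ℂ (Q n) → Prop
  | mk (σ θ : ZMod 2) (A B : Matrix (Fin (n + 1)) (Fin (n + 1)) ℂ) :
      EnvRel n
        (TensorAlgebra.ι ℂ (hom σ A) * TensorAlgebra.ι ℂ (hom θ B) -
          sgn σ θ • (TensorAlgebra.ι ℂ (hom θ B) * TensorAlgebra.ι ℂ (hom σ A)))
        (TensorAlgebra.ι ℂ (bracket (hom σ A) (hom θ B)))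

/-- The universal enveloping algebra `U(G)` of `G = q(n+1)`. Its left modules are exactly the
(not necessarily graded) `q(n+1)`-modules, and its submodules are the `q(n+1)`-submodules. -/
abbrev U (n : ℕ) : Type := RingQuot (EnvRel n)

/-- The canonical map `q(n+1) → U(q(n+1))`. -/
def ι (n : ℕ) : Q n →ₗ[ℂ] U n :=
  (RingQuot.mkAlgHom ℂ (EnvRel n)).toLinearMap ∘ₗ TensorAlgebra.ι ℂ

/-- The subalgebra `q(1) ⊕ q(n) + P` of `q(n+1)`, spanned by `e_{00}^σ`, `e_{ij}^σ` and
`e_{0i}^σ` with `i, j ≥ 1`: the elements whose entries `(i, 0)` with `i ≥ 1` vanish. -/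
def parabolic (n : ℕ) : Submodule ℂ (Q n) where
  carrier := {x | ∀ (σ : ZMod 2) (i : Fin n), x σ i.succ 0 = 0}
  add_mem' hx hy σ i := by simp [hx σ i, hy σ i]
  zero_mem' σ i := by simp
  smul_mem' c x hx σ i := by simp [hx σ i]

/-- The action of `q(1) ⊕ q(n) + P` on its one-dimensional module `ℂ v₀`:
`e_{00}^0 v₀ = p v₀`, `e_{00}^1 v₀ = √p v₀`, while `q(n)` and `P` act by zero. -/
def vacuumChar (n p : ℕ) (x : Q n) : ℂ := x 0 0 0 * (p : ℂ) + x 1 0 0 * (Real.sqrt p : ℂ)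

/-- The left ideal of `U(G)` generated by all `x - χ(x)`, where `x` is in `q(1) ⊕ q(n) + P` and
acts on `ℂ v₀` by the scalar `χ(x)`. -/
def vacuumIdeal (n p : ℕ) : Submodule (U n) (U n) :=
  Submodule.span (U n)
    {u | ∃ x ∈ parabolic n, u = ι n x - algebraMap ℂ (U n) (vacuumChar n p x)}

/-- The induced module `V̄_p = U(G) ⊗ ℂ v₀` (tensor product over `U(q(1) ⊕ q(n) + P)`). As
`ℂ v₀` is one-dimensional, this is the quotient of `U(G)` by the left ideal generated by the
elements `x - χ(x)`, and `u ⊗ v₀` is the class of `u`. -/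
abbrev Vbar (n p : ℕ) : Type := U n ⧸ vacuumIdeal n p

/-- The vacuum vector `v₀ = 1 ⊗ v₀`. -/
def vac (n p : ℕ) : Vbar n p := (vacuumIdeal n p).mkQ 1

/-- The creation operator `b_i⁺ = e_{i0}^0`, `i = 1, …, n`. -/
def bPlus (n : ℕ) (i : Fin n) : U n := ι n (e n 0 i.succ 0)

/-- The creation operator `f_i⁺ = e_{i0}^1`, `i = 1, …, n`. -/
def fPlus (n : ℕ) (i : Fin n) : U n := ι n (e n 1 i.succ 0)

/-- The vector `|p; k, l⟩ = (b_1⁺)^{k_1} (f_1⁺)^{l_1} ⋯ (b_n⁺)^{k_n} (f_n⁺)^{l_n} v₀`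
(used for `l_i ∈ {0, 1}`). -/
def ket {n : ℕ} (p : ℕ) (k l : Fin n → ℕ) : Vbar n p :=
  (List.ofFn fun i => bPlus n i ^ k i * fPlus n i ^ l i).prod • vac n p

/-- The vector `X(p; k, l)`, for `l_i ∈ {0, 1}`:
`(-1)^{l_1+⋯+l_n} √p |p; k, l⟩ - ∑_i (-1)^{l_1+⋯+l_i} l_i |k_i + 1, l_i - 1⟩`
`- ∑_i (-1)^{l_1+⋯+l_i} δ_{l_i,0} k_i |k_i - 1, l_i + 1⟩`, where only the changed labels are
shown. A subtraction that would leave the natural numbers comes with the coefficient `0`. -/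
def X {n : ℕ} (p : ℕ) (k l : Fin n → ℕ) : Vbar n p :=
  ((-1 : ℂ) ^ (∑ i, l i) * (Real.sqrt p : ℂ)) • ket p k l
    - ∑ i, ((-1 : ℂ) ^ (∑ j ∈ Finset.Iic i, l j) * (l i : ℂ)) •
        ket p (Function.update k i (k i + 1)) (Function.update l i (l i - 1))
    - ∑ i, ((-1 : ℂ) ^ (∑ j ∈ Finset.Iic i, l j) * (if l i = 0 then 1 else 0) * (k i : ℂ)) •
        ket p (Function.update k i (k i - 1)) (Function.update l i (l i + 1))

/-- The weight space `V(μ)` of a `q(n+1)`-module `V` for the weight `∑ μ_i ε_i`: the vectors on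
which every `e_{ii}^0` acts as the scalar `μ_i`. -/
def weightSpace {n : ℕ} (V : Type*) [AddCommGroup V] [Module ℂ V] [Module (U n) V]
    [IsScalarTower ℂ (U n) V] (μ : Fin (n + 1) → ℂ) : Submodule ℂ V where
  carrier := {v | ∀ i, ι n (e n 0 i i) • v = μ i • v}
  add_mem' hv hw i := by rw [smul_add, smul_add, hv i, hw i]
  zero_mem' i := by simp
  smul_mem' c v hv i := by
    rw [smul_comm (μ i) c v, ← hv i, ← algebraMap_smul (U n) c v, smul_smul,
      ← Algebra.commutes, ← smul_smul, algebraMap_smul]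

/-- The weight `λ_m = (p - ∑ m_i, m_1, …, m_n)`. -/
def lam {n : ℕ} (p : ℕ) (m : Fin n → ℕ) : Fin (n + 1) → ℂ :=
  Fin.cons ((p : ℂ) - ∑ i, (m i : ℂ)) fun i => (m i : ℂ)

/-- The level `∑ m_i` of the weight `λ_m`. -/
def level {n : ℕ} (m : Fin n → ℕ) : ℕ := ∑ i, m i

/-- The number of nonzero `m_i`. -/
def numNonzero {n : ℕ} (m : Fin n → ℕ) : ℕ := (Finset.univ.filter fun i => m i ≠ 0).card

/-- `M_p`: the maximal submodule of `V̄_p` different from `V̄_p`, i.e. the sum of all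
submodules different from `V̄_p`. -/
def M (n p : ℕ) : Submodule (U n) (Vbar n p) := sSup {N | N ≠ ⊤}

/-- The quotient module `V_p = V̄_p / M_p`. -/
abbrev V (n p : ℕ) : Type := Vbar n p ⧸ M n p

/-- The weight space `M_p(μ)`, as a subspace of `V̄_p`. -/
def MWeight (n p : ℕ) (μ : Fin (n + 1) → ℂ) : Submodule ℂ (Vbar n p) :=
  (M n p).restrictScalars ℂ ⊓ weightSpace (Vbar n p) μ

end QFock

end

/-!
The induced module is compared with an oscillator representation. If `x i`, `d i` are bosonic and
`y i`, `c i` fermionic creation and annihilation operators, `0 ≤ i ≤ n`, then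
`e_{ij}^0 ↦ x i d j + y i c j` and `e_{ij}^1 ↦ x i c j + y i d j` represent `q(n+1)`
(`Oscillators.rep`). The Fock module used here admits all integral powers of `x_0`, normalised so
that `d_0 x_0^a = x_0^{a-1}` and `x_0 · x_0^a = (a + 1) x_0^{a+1}`. The vector
`√p x_0^p + x_0^{p-1} y_0` satisfies the relations of the vacuum, which gives a homomorphism `Ψ` from
the induced module to the Fock module.

* `Ψ` is injective. Reading off the coefficient of `y_0`, the creation operators `b_i⁺` and `f_i⁺`
  become `x_i` and `± y_i` up to powers of `x_0`, so the ordered monomials in them, which span,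
  have linearly independent images (`IsInduced.basis`, `IsInduced.injective`). Weights and their
  multiplicities are read off from this basis.
* As `x_0` kills `x_0^{-1}`, the functions supported on negative powers of `x_0` form a submodule
  `Fock.negative n`, and the maximal submodule is its preimage (`IsInduced.sSup_eq`). Indeed
  `x_0 e_{0i}^0 - y_0 e_{0i}^1 = x_0² d_i`, and so no vector of positive level outside this preimage
  is mapped into it by all `e_{0i}^σ` (`Fock.apply_eq_zero_of_lower`). Hence every submodule that is
  not contained in the preimage contains the vacuum.
* A vector of level `L` has degree `p - L` in the mode `0`, of which the fermion `y_0` takes at most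
  one. So the power of `x_0` is negative if `L > p`, and nonnegative if `L < p`. If `L = p`, the
  power is `x_0^0` or `x_0^{-1} y_0`, and lying in the maximal submodule means being killed by
  `e_{00}^1` (`IsInduced.mem_iff_of_level_eq`).
* `X(p; k, l)` is `e_{00}^1` applied to the monomial vector (`IsInduced.e_one_smul_creation`). The
  square of `e_{00}^1` is `e_{00}^0`, which vanishes at level `p`, and the anticommutator of
  `e_{00}^1` with the parity operator is `2√p` (`IsInduced.parity_e_one_smul`). Thus kernel and
  image of `e_{00}^1` on a weight space of level `p` coincide, have half its dimension, and are
  spanned by the vectors `X(p; k, l)`.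

The arguments are carried out in any module with the properties `IsInduced`.
-/

noncomputable section

namespace QFock

variable {n : ℕ}

/-! ### Relations in `U(G)` and weights of modules -/

theorem bracket_hom (σ θ : ZMod 2) (A B : Matrix (Fin (n + 1)) (Fin (n + 1)) ℂ) :
    bracket (hom σ A) (hom θ B) = hom (σ + θ) (A * B - sgn σ θ • (B * A)) := by
  have hsum : ∀ f : ZMod 2 → Q n, ∑ x, f x = f 0 + f 1 := fun f => Fin.sum_univ_two f
  have h10 : (1 : ZMod 2) ≠ 0 := by decide
  have key : ∀ τ : ZMod 2, τ = 0 ∨ τ = 1 := by decide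
  simp only [bracket, hsum]
  rcases key σ with rfl | rfl <;> rcases key θ with rfl | rfl <;> simp [h10, h10.symm]

theorem ι_mul_sub (σ θ : ZMod 2) (A B : Matrix (Fin (n + 1)) (Fin (n + 1)) ℂ) :
    ι n (hom σ A) * ι n (hom θ B) - sgn σ θ • (ι n (hom θ B) * ι n (hom σ A)) =
      ι n (hom (σ + θ) (A * B - sgn σ θ • (B * A))) := by
  rw [← bracket_hom]
  have := RingQuot.mkAlgHom_rel ℂ (EnvRel.mk σ θ A B)
  simpa [ι] using this

/-- The defining relations of `U(G)` on the basis elements. -/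
theorem ι_e_mul (σ θ : ZMod 2) (i j k l : Fin (n + 1)) :
    ι n (e n σ i j) * ι n (e n θ k l) = sgn σ θ • (ι n (e n θ k l) * ι n (e n σ i j)) +
      ((if j = k then ι n (e n (σ + θ) i l) else 0) -
        sgn σ θ • (if i = l then ι n (e n (σ + θ) k j) else 0)) := by
  rw [← sub_eq_iff_eq_add', e, e, ι_mul_sub]
  have h1 : ∀ i j k l : Fin (n + 1),
      Matrix.single i j (1 : ℂ) * Matrix.single k l 1 =
        if j = k then Matrix.single i l 1 else 0 := by
    intro i j k l
    split_ifs with h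
    · subst h; simp
    · simp [h]
  rw [h1, h1]
  simp only [hom, Pi.single_sub, Pi.single_smul, map_sub, map_smul, e]
  congr 1
  · split_ifs <;> simp
  · simp only [eq_comm (a := l)]
    split_ifs <;> simp

theorem sgn_zero_left (θ : ZMod 2) : sgn 0 θ = 1 := by simp [sgn]

theorem sgn_zero_right (σ : ZMod 2) : sgn σ 0 = 1 := by simp [sgn]

theorem sgn_one_one : sgn 1 1 = -1 := by
  have : (1 : ZMod 2).val = 1 := rfl
  simp [sgn, this]

theorem zmod_two_cases (σ : ZMod 2) : σ = 0 ∨ σ = 1 := by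
  revert σ; decide

/-- An element of `q(n+1)` is a combination of the basis elements. -/
theorem eq_sum_e (x : Q n) : x = ∑ σ, ∑ i, ∑ j, x σ i j • e n σ i j := by
  have hsum : ∀ f : ZMod 2 → Q n, ∑ x, f x = f 0 + f 1 := fun f => Fin.sum_univ_two f
  have h10 : (1 : ZMod 2) ≠ 0 := by decide
  have h (σ : ZMod 2) : ∑ i, ∑ j, x σ i j • e n σ i j = hom σ (x σ) := by
    conv_rhs => rw [Matrix.matrix_eq_sum_single (x σ)]
    ext τ a b
    simp only [e, hom, ← Pi.single_smul, Matrix.smul_single, smul_eq_mul, mul_one]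
    rcases eq_or_ne τ σ with rfl | hne
    · simp
    · simp [hne]
  simp only [h, hsum]
  ext τ a b
  rcases zmod_two_cases τ with rfl | rfl <;> simp [h10, h10.symm]

/-- `U(G)` is generated by `q(n+1)`. -/
theorem U_induction {C : U n → Prop} (algebraMap : ∀ c : ℂ, C (algebraMap ℂ (U n) c))
    (ι : ∀ x, C (ι n x)) (mul : ∀ a b, C a → C b → C (a * b))
    (add : ∀ a b, C a → C b → C (a + b)) (u : U n) : C u := by
  obtain ⟨t, rfl⟩ := RingQuot.mkAlgHom_surjective ℂ (EnvRel n) u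
  induction t using TensorAlgebra.induction with
  | algebraMap r => simpa using algebraMap r
  | ι x => exact ι x
  | mul a b ha hb => simpa using mul _ _ ha hb
  | add a b ha hb => simpa using add _ _ ha hb

section module

variable {V : Type*} [AddCommGroup V] [Module ℂ V] [Module (U n) V] [IsScalarTower ℂ (U n) V]

theorem ι_smul_eq_sum (x : Q n) (v : V) :
    ι n x • v = ∑ σ, ∑ i, ∑ j, x σ i j • ι n (e n σ i j) • v := by
  conv_lhs => rw [eq_sum_e x]
  simp only [map_sum, map_smul, Finset.sum_smul, smul_assoc]

/-- A subspace stable under the basis elements of `q(n+1)` is stable under `U(G)`. -/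
theorem smul_mem_of_e (S : Submodule ℂ V)
    (h : ∀ σ i j, ∀ v ∈ S, ι n (e n σ i j) • v ∈ S) (u : U n) : ∀ v ∈ S, u • v ∈ S := by
  induction u using U_induction with
  | algebraMap c => intro v hv; rw [algebraMap_smul]; exact S.smul_mem c hv
  | ι x =>
    intro v hv
    rw [ι_smul_eq_sum]
    exact S.sum_mem fun σ _ => S.sum_mem fun i _ => S.sum_mem fun j _ =>
      S.smul_mem _ (h σ i j v hv)
  | mul a b ha hb => intro v hv; rw [mul_smul]; exact ha _ (hb _ hv)
  | add a b ha hb => intro v hv; rw [add_smul]; exact S.add_mem (ha _ hv) (hb _ hv)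

theorem U_smul_comm (u : U n) (c : ℂ) (v : V) : u • c • v = c • u • v := by
  rw [← algebraMap_smul (U n) c v, smul_smul, ← Algebra.commutes, ← smul_smul, algebraMap_smul]

theorem e_smul_e_smul (σ θ : ZMod 2) (i j k l : Fin (n + 1)) (v : V) :
    ι n (e n σ i j) • ι n (e n θ k l) • v = sgn σ θ • ι n (e n θ k l) • ι n (e n σ i j) • v +
      ((if j = k then ι n (e n (σ + θ) i l) • v else 0) -
        sgn σ θ • (if i = l then ι n (e n (σ + θ) k j) • v else 0)) := by
  rw [smul_smul, ι_e_mul, add_smul, sub_smul, smul_assoc, smul_assoc, mul_smul]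
  split_ifs <;> simp

/-- The basis element `e_{ij}^σ` shifts weights by `ε_i - ε_j`. -/
theorem e_smul_mem_weightSpace (σ : ZMod 2) (i j : Fin (n + 1)) {μ : Fin (n + 1) → ℂ} {v : V}
    (hv : v ∈ weightSpace V μ) :
    ι n (e n σ i j) • v ∈ weightSpace V (μ + Pi.single i 1 - Pi.single j 1) := by
  intro a
  rw [e_smul_e_smul, hv a, sgn_zero_left, U_smul_comm]
  simp only [zero_add, one_smul, Pi.add_apply, Pi.sub_apply, Pi.single_apply, sub_smul, add_smul]
  split_ifs with h1 h2 h2 <;> simp_all [sub_eq_add_neg]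

/-- Weight components of a member of a submodule belong to the submodule. The weights are indexed
by an injective family `wt`, so that distinct indices are separated by some `e_{ii}^0`. -/
theorem weight_component_mem (N : Submodule (U n) V) {I : Type*} (wt : I → Fin (n + 1) → ℂ)
    (hwt : Function.Injective wt) (s : Finset I) :
    ∀ v : I → V, (∀ a ∈ s, v a ∈ weightSpace V (wt a)) → ∑ a ∈ s, v a ∈ N →
      ∀ a ∈ s, v a ∈ N := by
  classical
  induction s using Finset.induction_on with
  | empty => simp
  | insert a s ha ih =>
    intro v hv hsum
    -- `e_{ii}^0 - wt a i` removes the component `a` and rescales the others.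
    have key : ∀ b ∈ s, v b ∈ N := by
      intro b hb
      have hab : wt b ≠ wt a := fun h => ha (hwt h ▸ hb)
      obtain ⟨i, hi⟩ := Function.ne_iff.1 hab
      have h1 : ∀ c ∈ insert a s, ι n (e n 0 i i) • v c - wt a i • v c =
          (wt c i - wt a i) • v c := by
        intro c hc
        rw [hv c hc i, sub_smul]
      have h2 : ∑ c ∈ s, (wt c i - wt a i) • v c ∈ N := by
        have : ι n (e n 0 i i) • (∑ c ∈ insert a s, v c) - wt a i • (∑ c ∈ insert a s, v c) =
            ∑ c ∈ s, (wt c i - wt a i) • v c := by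
          rw [Finset.smul_sum, Finset.smul_sum, ← Finset.sum_sub_distrib,
            Finset.sum_congr rfl h1, Finset.sum_insert ha, sub_self, zero_smul, zero_add]
        rw [← this]
        exact N.sub_mem (N.smul_mem _ hsum) (N.smul_of_tower_mem _ hsum)
      have h3 := ih (fun c => (wt c i - wt a i) • v c)
        (fun c hc => (weightSpace V (wt c)).smul_mem _ (hv c (Finset.mem_insert_of_mem hc))) h2 b hb
      have h4 := N.smul_of_tower_mem (wt b i - wt a i)⁻¹ h3
      rwa [smul_smul, inv_mul_cancel₀ (sub_ne_zero.2 hi), one_smul] at h4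
    intro b hb
    rcases Finset.mem_insert.1 hb with rfl | hb
    · rw [Finset.sum_insert ha] at hsum
      exact (N.add_mem_iff_left (N.sum_mem key)).1 hsum
    · exact key b hb

/-- In a module with a basis of weight vectors, a weight space is spanned by basis vectors. -/
theorem weightSpace_eq_span {I : Type*} (b : Module.Basis I ℂ V) (wt : I → Fin (n + 1) → ℂ)
    (hb : ∀ a, b a ∈ weightSpace V (wt a)) (μ : Fin (n + 1) → ℂ) :
    weightSpace V μ = Submodule.span ℂ (b '' {a | wt a = μ}) := by
  apply le_antisymm
  · intro v hv
    rw [b.mem_span_image]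
    intro a ha
    have hc : b.repr v a ≠ 0 := by simpa using ha
    funext j
    have h1 : ∀ w : V, b.repr (ι n (e n 0 j j) • w) a = wt a j * b.repr w a := by
      intro w
      induction b.mem_span w using Submodule.span_induction with
      | zero => simp
      | mem w hw =>
        obtain ⟨c, rfl⟩ := hw
        rw [hb c j, map_smul, b.repr_self]
        rcases eq_or_ne c a with rfl | h
        · simp
        · simp [h]
      | add x y _ _ hx hy =>
        rw [smul_add, map_add, Finsupp.add_apply, hx, hy, map_add, Finsupp.add_apply, mul_add]
      | smul c x _ hx =>
        rw [U_smul_comm, map_smul, Finsupp.smul_apply, hx, map_smul, Finsupp.smul_apply,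
          smul_eq_mul, smul_eq_mul, mul_left_comm]
    have h2 := h1 v
    rw [hv j, map_smul, Finsupp.smul_apply, smul_eq_mul] at h2
    exact (mul_right_cancel₀ hc h2).symm
  · rw [Submodule.span_le]
    rintro _ ⟨a, rfl, rfl⟩
    exact hb a

end module

/-! ### The oscillator representation of `q(n+1)` -/

/-- Bosonic operators `x i`, `d i` and fermionic operators `y i`, `c i` satisfying the canonical
commutation and anticommutation relations: `x` and `y` create, `d` and `c` annihilate, so that `d i`
and `c i` play the parts of the derivatives with respect to `x i` and `y i`. -/
structure Oscillators (R : Type*) [Ring R] (I : Type*) [DecidableEq I] where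
  x : I → R
  d : I → R
  y : I → R
  c : I → R
  xx : ∀ i j, x i * x j = x j * x i
  dd : ∀ i j, d i * d j = d j * d i
  dx : ∀ i j, d i * x j = x j * d i + if i = j then 1 else 0
  yy : ∀ i j, y i * y j = -(y j * y i)
  cc : ∀ i j, c i * c j = -(c j * c i)
  cy : ∀ i j, c i * y j = -(y j * c i) + if i = j then 1 else 0
  yx : ∀ i j, y i * x j = x j * y i
  yd : ∀ i j, y i * d j = d j * y i
  cx : ∀ i j, c i * x j = x j * c i
  cd : ∀ i j, c i * d j = d j * c i

namespace Oscillators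

variable {R I : Type*} [Ring R] [DecidableEq I] (O : Oscillators R I)

/-- The bilinear that represents `e_{ij}^0`; it commutes with the fermion parity. -/
def even (i j : I) : R := O.x i * O.d j + O.y i * O.c j

/-- The bilinear that represents `e_{ij}^1`; it anticommutes with the fermion parity. -/
def odd (i j : I) : R := O.x i * O.c j + O.y i * O.d j

theorem even_x (i j k : I) :
    O.even i j * O.x k = O.x k * O.even i j + if j = k then O.x i else 0 := by
  rw [even, add_mul, mul_assoc, mul_assoc, O.dx j k, O.cx j k, ← mul_assoc (O.y i), O.yx i k,
    mul_add, ← mul_assoc (O.x i), O.xx i k]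
  split_ifs <;> noncomm_ring

theorem even_d (i j k : I) :
    O.even i j * O.d k = O.d k * O.even i j - if i = k then O.d j else 0 := by
  have h : O.x i * O.d k = O.d k * O.x i - if i = k then 1 else 0 := by
    rw [O.dx k i]
    simp only [eq_comm (a := k)]
    abel
  rw [even, add_mul, mul_assoc, mul_assoc, O.dd j k, O.cd j k, ← mul_assoc (O.y i), O.yd i k,
    ← mul_assoc (O.x i), h]
  split_ifs <;> noncomm_ring

theorem even_y (i j k : I) :
    O.even i j * O.y k = O.y k * O.even i j + if j = k then O.y i else 0 := by
  rw [even, add_mul, mul_assoc, mul_assoc, O.cy j k, ← O.yd k j, mul_add, mul_neg,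
    ← mul_assoc (O.y i), O.yy i k, ← mul_assoc (O.x i), ← O.yx k i]
  split_ifs <;> noncomm_ring

theorem even_c (i j k : I) :
    O.even i j * O.c k = O.c k * O.even i j - if i = k then O.c j else 0 := by
  have h : O.y i * O.c k = -(O.c k * O.y i) + if i = k then 1 else 0 := by
    rw [O.cy k i]
    simp only [eq_comm (a := k)]
    abel
  rw [even, add_mul, mul_assoc, mul_assoc, O.cc j k, ← O.cd k j, mul_neg,
    ← mul_assoc (O.x i), ← O.cx k i, ← mul_assoc (O.y i), h]
  split_ifs <;> noncomm_ring

theorem odd_x (i j k : I) :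
    O.odd i j * O.x k = O.x k * O.odd i j + if j = k then O.y i else 0 := by
  rw [odd, add_mul, mul_assoc, mul_assoc, O.dx j k, O.cx j k, mul_add, ← mul_assoc (O.y i),
    O.yx i k,
    ← mul_assoc (O.x i), O.xx i k]
  split_ifs <;> noncomm_ring

theorem odd_d (i j k : I) :
    O.odd i j * O.d k = O.d k * O.odd i j - if i = k then O.c j else 0 := by
  have h : O.x i * O.d k = O.d k * O.x i - if i = k then 1 else 0 := by
    rw [O.dx k i]
    simp only [eq_comm (a := k)]
    abel
  rw [odd, add_mul, mul_assoc, mul_assoc, O.dd j k, O.cd j k, ← mul_assoc (O.y i), O.yd i k,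
    ← mul_assoc (O.x i), h]
  split_ifs <;> noncomm_ring

theorem odd_y (i j k : I) :
    O.odd i j * O.y k = -(O.y k * O.odd i j) + if j = k then O.x i else 0 := by
  rw [odd, add_mul, mul_assoc, mul_assoc, O.cy j k, ← O.yd k j, mul_add, mul_neg,
    ← mul_assoc (O.y i), O.yy i k, ← mul_assoc (O.x i), ← O.yx k i]
  split_ifs <;> noncomm_ring

theorem odd_c (i j k : I) :
    O.odd i j * O.c k = -(O.c k * O.odd i j) + if i = k then O.d j else 0 := by
  have h : O.y i * O.c k = -(O.c k * O.y i) + if i = k then 1 else 0 := by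
    rw [O.cy k i]
    simp only [eq_comm (a := k)]
    abel
  rw [odd, add_mul, mul_assoc, mul_assoc, O.cc j k, ← O.cd k j, mul_neg,
    ← mul_assoc (O.x i), ← O.cx k i, ← mul_assoc (O.y i), h]
  split_ifs <;> noncomm_ring

theorem even_even (i j k l : I) :
    O.even i j * O.even k l = O.even k l * O.even i j +
      ((if j = k then O.even i l else 0) - (if i = l then O.even k j else 0)) := by
  rw [show O.even k l = O.x k * O.d l + O.y k * O.c l from rfl, mul_add, ← mul_assoc, ← mul_assoc,
    O.even_x, O.even_y, add_mul, add_mul,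
    mul_assoc, mul_assoc, O.even_d, O.even_c]
  simp only [even]
  split_ifs <;> noncomm_ring

theorem even_odd (i j k l : I) :
    O.even i j * O.odd k l = O.odd k l * O.even i j +
      ((if j = k then O.odd i l else 0) - (if i = l then O.odd k j else 0)) := by
  rw [show O.odd k l = O.x k * O.c l + O.y k * O.d l from rfl, mul_add, ← mul_assoc, ← mul_assoc,
    O.even_x, O.even_y, add_mul, add_mul,
    mul_assoc, mul_assoc, O.even_d, O.even_c]
  simp only [even, odd]
  split_ifs <;> noncomm_ring

theorem odd_odd (i j k l : I) :
    O.odd i j * O.odd k l = -(O.odd k l * O.odd i j) +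
      ((if j = k then O.even i l else 0) + (if i = l then O.even k j else 0)) := by
  rw [show O.odd k l = O.x k * O.c l + O.y k * O.d l from rfl, mul_add, ← mul_assoc, ← mul_assoc,
    O.odd_x, O.odd_y, add_mul, add_mul,
    neg_mul, mul_assoc, mul_assoc, O.odd_d, O.odd_c]
  simp only [even, odd]
  split_ifs <;> noncomm_ring

section representation

variable {R : Type*} [Ring R] [Algebra ℂ R] (O : Oscillators R (Fin (n + 1)))

/-- The operator of a homogeneous element `e_{ij}^σ`. -/
def op (σ : ZMod 2) (i j : Fin (n + 1)) : R := if σ = 0 then O.even i j else O.odd i j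

/-- The oscillator representation on `q(n+1)`, before extension to `U(G)`. -/
def lin : Q n →ₗ[ℂ] R :=
  ∑ σ, ∑ i, ∑ j, (LinearMap.toSpanSingleton ℂ R (O.op σ i j)).comp
    ((Matrix.entryLinearMap ℂ ℂ i j).comp (LinearMap.proj σ))

theorem lin_hom_single (σ : ZMod 2) (i j : Fin (n + 1)) (a : ℂ) :
    O.lin (hom σ (Matrix.single i j a)) = a • O.op σ i j := by
  have hsum : ∀ f : ZMod 2 → R, ∑ x, f x = f 0 + f 1 := fun f => Fin.sum_univ_two f
  have h10 : (1 : ZMod 2) ≠ 0 := by decide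
  have h : ∀ τ, ∑ k, ∑ l, (hom σ (Matrix.single i j a) : Q n) τ k l • O.op τ k l =
      if τ = σ then a • O.op σ i j else 0 := by
    intro τ
    split_ifs with h
    · subst h
      rw [Finset.sum_eq_single i, Finset.sum_eq_single j]
      · simp
      · intro b _ hb; simp [hb.symm]
      · simp
      · intro b _ hb; simp [hb.symm]
      · simp
    · simp [hom, h]
  have h2 : O.lin (hom σ (Matrix.single i j a)) =
      ∑ τ, ∑ k, ∑ l, (hom σ (Matrix.single i j a) : Q n) τ k l • O.op τ k l := by
    simp [lin, LinearMap.sum_apply]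
  rw [h2]
  simp [h]

/-- The bilinears satisfy the relations of the basis elements of `q(n+1)`. -/
theorem op_mul_op (σ θ : ZMod 2) (i j k l : Fin (n + 1)) :
    O.op σ i j * O.op θ k l = sgn σ θ • (O.op θ k l * O.op σ i j) +
      ((if j = k then O.op (σ + θ) i l else 0) -
        sgn σ θ • (if i = l then O.op (σ + θ) k j else 0)) := by
  have h10 : (1 : ZMod 2) ≠ 0 := by decide
  have h11 : (1 : ZMod 2) + 1 = 0 := by decide
  rcases zmod_two_cases σ with rfl | rfl <;> rcases zmod_two_cases θ with rfl | rfl <;>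
    simp only [sgn_zero_left, sgn_zero_right, sgn_one_one, op, if_pos, if_neg h10, zero_add,
      add_zero, h11, one_smul, neg_one_smul, sub_neg_eq_add]
  · exact O.even_even i j k l
  · exact O.even_odd i j k l
  · have := O.even_odd k l i j
    simp only [eq_comm (a := l), eq_comm (a := k)] at this
    rw [this]; abel
  · exact O.odd_odd i j k l

theorem lin_mul_lin (σ θ : ZMod 2) (A B : Matrix (Fin (n + 1)) (Fin (n + 1)) ℂ) :
    O.lin (hom σ A) * O.lin (hom θ B) - sgn σ θ • (O.lin (hom θ B) * O.lin (hom σ A)) =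
      O.lin (hom (σ + θ) (A * B - sgn σ θ • (B * A))) := by
  have hs : ∀ (i j k l : Fin (n + 1)) (a b : ℂ), Matrix.single i j a * Matrix.single k l b =
        if j = k then Matrix.single i l (a * b) else 0 := by
    intro i j k l a b
    split_ifs with h
    · subst h; simp
    · simp [h]
  induction A using Matrix.induction_on' with
  | h_zero => simp
  | h_add A A' h h' =>
    simp only [hom, Pi.single_add, map_add, add_mul, mul_add, smul_add, Pi.single_sub, map_sub]
      at h h' ⊢
    rw [add_sub_add_comm, h, h']; abel
  | h_std_basis i j a =>
    induction B using Matrix.induction_on' with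
    | h_zero => simp
    | h_add A A' h h' =>
      simp only [hom, Pi.single_add, map_add, add_mul, mul_add, smul_add, Pi.single_sub, map_sub]
        at h h' ⊢
      rw [add_sub_add_comm, h, h']; abel
    | h_std_basis k l b =>
      have h1 : O.lin (hom (σ + θ) (Matrix.single i j a * Matrix.single k l b)) =
          (a * b) • if j = k then O.op (σ + θ) i l else 0 := by
        rw [hs]; split_ifs
        · rw [lin_hom_single]
        · simp
      have h2 : O.lin (hom (σ + θ) (Matrix.single k l b * Matrix.single i j a)) =
          (a * b) • if i = l then O.op (σ + θ) k j else 0 := by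
        rw [hs]; simp only [eq_comm (a := l)]; split_ifs
        · rw [lin_hom_single, mul_comm]
        · simp
      rw [lin_hom_single, lin_hom_single, hom, Pi.single_sub, Pi.single_smul, map_sub, map_smul,
        ← hom, ← hom, h1, h2, smul_mul_smul_comm, smul_mul_smul_comm, O.op_mul_op σ θ i j k l,
        mul_comm b a]
      module

/-- The oscillator representation of `U(G)`, determined by `e_{ij}^σ ↦ op σ i j`. -/
def rep : U n →ₐ[ℂ] R :=
  RingQuot.liftAlgHom ℂ ⟨TensorAlgebra.lift ℂ O.lin, by
    rintro _ _ ⟨σ, θ, A, B⟩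
    simp only [map_sub, map_mul, map_smul, TensorAlgebra.lift_ι_apply, bracket_hom]
    exact O.lin_mul_lin σ θ A B⟩

theorem rep_ι (x : Q n) : O.rep (ι n x) = O.lin x := by
  simp [rep, ι]

theorem rep_e (σ : ZMod 2) (i j : Fin (n + 1)) : O.rep (ι n (e n σ i j)) = O.op σ i j := by
  rw [rep_ι, e, lin_hom_single, one_smul]

end representation

end Oscillators

/-! ### The Fock module -/

/-- The space of all complex functions of boson exponents `k : Fin (n + 1) → ℤ` and fermion
occupation numbers `l : Fin (n + 1) → ZMod 2`; `f k l` is the coefficient of the monomial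
`x^k y^l`. Exponents may be negative and the support may be infinite, which makes all operators
below weighted substitutions without side conditions. -/
def Fock (n : ℕ) : Type := (Fin (n + 1) → ℤ) → (Fin (n + 1) → ZMod 2) → ℂ

namespace Fock

instance : AddCommGroup (Fock n) := inferInstanceAs (AddCommGroup (_ → _ → ℂ))
instance : Module ℂ (Fock n) := inferInstanceAs (Module ℂ (_ → _ → ℂ))

@[ext] theorem ext {f g : Fock n} (h : ∀ k l, f k l = g k l) : f = g :=
  funext fun k => funext fun l => h k l

@[simp] theorem add_apply (f g : Fock n) (k l) : (f + g) k l = f k l + g k l := rfl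
@[simp] theorem zero_apply (k l) : (0 : Fock n) k l = 0 := rfl
@[simp] theorem neg_apply (f : Fock n) (k l) : (-f) k l = -f k l := rfl
@[simp] theorem smul_apply (a : ℂ) (f : Fock n) (k l) : (a • f) k l = a * f k l := rfl

/-- The weight of the substitution by which `x i` acts. The mode `0` is normalised differently from
the others: there `x` carries the factor and `d` is a pure shift. Hence `x 0` cannot pass from the
exponent `-1` to the exponent `0`, while powers of `d 0` never vanish. -/
def raiseCoeff (i : Fin (n + 1)) (a : ℤ) : ℂ := if i = 0 then a else 1

/-- The weight of the substitution by which `d i` acts; see `raiseCoeff`. -/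
def lowerCoeff (i : Fin (n + 1)) (a : ℤ) : ℂ := if i = 0 then 1 else a + 1

theorem coeff_comm (i : Fin (n + 1)) (a : ℤ) :
    lowerCoeff i a * raiseCoeff i (a + 1) = raiseCoeff i a * lowerCoeff i (a - 1) + 1 := by
  unfold raiseCoeff lowerCoeff
  split_ifs <;> simp

/-- The weighted substitution `(k, l) ↦ c k l * f (φ k) (ψ l)`. -/
def substFun (c : (Fin (n + 1) → ℤ) → (Fin (n + 1) → ZMod 2) → ℂ)
    (φ : (Fin (n + 1) → ℤ) → Fin (n + 1) → ℤ) (ψ : (Fin (n + 1) → ZMod 2) → Fin (n + 1) → ZMod 2)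
    (f : Fock n) : Fock n := fun k l => c k l * f (φ k) (ψ l)

theorem substFun_apply (c φ ψ) (f : Fock n) (k l) :
    substFun c φ ψ f k l = c k l * f (φ k) (ψ l) := rfl

/-- The function `substFun c φ ψ f`, as a linear operator in `f`. -/
def substOp (c : (Fin (n + 1) → ℤ) → (Fin (n + 1) → ZMod 2) → ℂ)
    (φ : (Fin (n + 1) → ℤ) → Fin (n + 1) → ℤ) (ψ : (Fin (n + 1) → ZMod 2) → Fin (n + 1) → ZMod 2) :
    Module.End ℂ (Fock n) where
  toFun := substFun c φ ψ
  map_add' f g := by ext; simp [substFun_apply, mul_add]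
  map_smul' a f := by ext; simp [substFun_apply, mul_left_comm]

/-- The boson creation operator of mode `i`. -/
def xOp (i : Fin (n + 1)) : Module.End ℂ (Fock n) :=
  substOp (fun k _ => raiseCoeff i (k i)) (fun k => k - Pi.single i 1) id

/-- The boson annihilation operator of mode `i`. -/
def dOp (i : Fin (n + 1)) : Module.End ℂ (Fock n) :=
  substOp (fun k _ => lowerCoeff i (k i)) (fun k => k + Pi.single i 1) id

/-- The Jordan-Wigner sign: the parity of the number of occupied fermion modes below `i`. -/
def jw (i : Fin (n + 1)) (l : Fin (n + 1) → ZMod 2) : ℂ := ∏ j ∈ Finset.Iio i, (-1) ^ (l j).val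

/-- The fermion operator that changes the occupation number of mode `i` to `t`, and kills the
monomials where it already is `t`: creation for `t = 1`, annihilation for `t = 0`. -/
def flip (t : ZMod 2) (i : Fin (n + 1)) : Module.End ℂ (Fock n) :=
  substOp (fun _ l => if l i = t then jw i l else 0) id (fun l => l + Pi.single i 1)

theorem xOp_apply (i : Fin (n + 1)) (f : Fock n) (k l) :
    xOp i f k l = raiseCoeff i (k i) * f (k - Pi.single i 1) l := rfl

theorem dOp_apply (i : Fin (n + 1)) (f : Fock n) (k l) :
    dOp i f k l = lowerCoeff i (k i) * f (k + Pi.single i 1) l := rfl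

theorem flip_apply (t : ZMod 2) (i : Fin (n + 1)) (f : Fock n) (k l) :
    flip t i f k l = if l i = t then jw i l * f k (l + Pi.single i 1) else 0 :=
  ite_zero_mul _ _ _

theorem jw_add_single_self (i : Fin (n + 1)) (l : Fin (n + 1) → ZMod 2) :
    jw i (l + Pi.single i 1) = jw i l := by
  refine Finset.prod_congr rfl fun j hj => ?_
  rw [Pi.add_apply, Pi.single_eq_of_ne (Finset.mem_Iio.1 hj).ne, add_zero]

theorem jw_add_single_of_lt {i j : Fin (n + 1)} (h : i < j) (l : Fin (n + 1) → ZMod 2) :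
    jw i (l + Pi.single j 1) = jw i l := by
  refine Finset.prod_congr rfl fun a ha => ?_
  rw [Pi.add_apply, Pi.single_eq_of_ne ((Finset.mem_Iio.1 ha).trans h).ne, add_zero]

theorem jw_add_single_of_gt {i j : Fin (n + 1)} (h : i < j) (l : Fin (n + 1) → ZMod 2) :
    jw j (l + Pi.single i 1) = -jw j l := by
  have hi : i ∈ Finset.Iio j := Finset.mem_Iio.2 h
  have hs : ∀ a : ZMod 2, (-1 : ℂ) ^ (a + 1).val = -(-1) ^ a.val := by
    intro a
    have h1 : (1 : ZMod 2).val = 1 := rfl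
    have h2 : (1 + 1 : ZMod 2).val = 0 := rfl
    rcases zmod_two_cases a with rfl | rfl
    · simp [h1]
    · rw [h1, h2]; simp
  rw [jw, jw, ← Finset.mul_prod_erase _ _ hi, ← Finset.mul_prod_erase _ _ hi, Pi.add_apply,
    Pi.single_eq_same, hs, neg_mul]
  congr 2
  refine Finset.prod_congr rfl fun a ha => ?_
  rw [Pi.add_apply, Pi.single_eq_of_ne (Finset.ne_of_mem_erase ha), add_zero]

theorem jw_mul_self (i : Fin (n + 1)) (l : Fin (n + 1) → ZMod 2) : jw i l * jw i l = 1 := by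
  rw [jw, ← Finset.prod_mul_distrib]
  refine Finset.prod_eq_one fun j _ => ?_
  rw [← mul_pow]; simp

theorem jw_ne_zero (i : Fin (n + 1)) (l : Fin (n + 1) → ZMod 2) : jw i l ≠ 0 :=
  left_ne_zero_of_mul_eq_one (jw_mul_self i l)

theorem flip_flip_of_lt (t u : ZMod 2) {i j : Fin (n + 1)} (h : i < j) :
    flip t i * flip u j = -(flip u j * flip t i) := by
  refine LinearMap.ext fun f => ext fun k l => ?_
  simp only [Module.End.mul_apply, LinearMap.neg_apply, neg_apply, flip_apply, Pi.add_apply,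
    Pi.single_eq_of_ne h.ne, Pi.single_eq_of_ne h.ne', add_zero, jw_add_single_of_lt h,
    jw_add_single_of_gt h, add_right_comm l (Pi.single i 1)]
  split_ifs <;> simp [mul_left_comm]

theorem flip_flip_self (t : ZMod 2) (i : Fin (n + 1)) : flip t i * flip t i = 0 := by
  refine LinearMap.ext fun f => ext fun k l => ?_
  simp only [Module.End.mul_apply, flip_apply, Pi.add_apply, Pi.single_eq_same]
  split_ifs with h1 h2
  · rw [h1] at h2; simp at h2
  · simp
  · rfl

theorem flip_flip (t : ZMod 2) (i j : Fin (n + 1)) :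
    flip t i * flip t j = -(flip t j * flip t i) := by
  rcases lt_trichotomy i j with h | rfl | h
  · exact flip_flip_of_lt t t h
  · simp [flip_flip_self]
  · rw [flip_flip_of_lt t t h, neg_neg]

theorem flip_zero_flip_one_self (i : Fin (n + 1)) :
    (flip 0 i * flip 1 i : Module.End ℂ (Fock n)) = -(flip 1 i * flip 0 i) + 1 := by
  have h10 : (1 : ZMod 2) ≠ 0 := by decide
  have h11 : (1 : ZMod 2) + 1 = 0 := by decide
  have hl : ∀ l : Fin (n + 1) → ZMod 2, l + Pi.single i 1 + Pi.single i 1 = l := by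
    intro l
    rw [add_assoc, ← Pi.single_add, h11, Pi.single_zero, add_zero]
  refine LinearMap.ext fun f => ext fun k l => ?_
  simp only [Module.End.mul_apply, LinearMap.neg_apply, LinearMap.add_apply, neg_apply, add_apply,
    Module.End.one_apply, flip_apply, Pi.add_apply, Pi.single_eq_same, jw_add_single_self, hl]
  rcases zmod_two_cases (l i) with h | h <;>
    simp [h, h10, h10.symm, h11, ← mul_assoc, jw_mul_self]

/-- The canonical operators on the Fock space. -/
def osc (n : ℕ) : Oscillators (Module.End ℂ (Fock n)) (Fin (n + 1)) where
  x := xOp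
  d := dOp
  y := flip 1
  c := flip 0
  xx i j := by
    rcases eq_or_ne i j with rfl | h
    · rfl
    refine LinearMap.ext fun f => ext fun k l => ?_
    simp [xOp_apply, h, h.symm, sub_right_comm k (Pi.single i 1), mul_left_comm]
  dd i j := by
    rcases eq_or_ne i j with rfl | h
    · rfl
    refine LinearMap.ext fun f => ext fun k l => ?_
    simp [dOp_apply, h, h.symm, add_right_comm k (Pi.single i 1), mul_left_comm]
  dx i j := by
    refine LinearMap.ext fun f => ext fun k l => ?_
    rcases eq_or_ne i j with rfl | h
    · have := coeff_comm i (k i)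
      simp [xOp_apply, dOp_apply, ← mul_assoc, this, add_mul]
    · simp [xOp_apply, dOp_apply, h, h.symm, mul_left_comm, sub_add_eq_add_sub]
  yy := flip_flip 1
  cc := flip_flip 0
  cy i j := by
    rcases lt_trichotomy i j with h | rfl | h
    · simp [flip_flip_of_lt 0 1 h, h.ne]
    · simp [flip_zero_flip_one_self]
    · simp [flip_flip_of_lt 1 0 h, h.ne']
  yx i j := by
    refine LinearMap.ext fun f => ext fun k l => ?_
    simp [xOp_apply, flip_apply, mul_left_comm]
  yd i j := by
    refine LinearMap.ext fun f => ext fun k l => ?_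
    simp [dOp_apply, flip_apply, mul_left_comm]
  cx i j := by
    refine LinearMap.ext fun f => ext fun k l => ?_
    simp [xOp_apply, flip_apply, mul_left_comm]
  cd i j := by
    refine LinearMap.ext fun f => ext fun k l => ?_
    simp [dOp_apply, flip_apply, mul_left_comm]

instance : Module (U n) (Fock n) := Module.compHom _ (osc n).rep.toRingHom

theorem smul_def (u : U n) (f : Fock n) : u • f = (osc n).rep u f := rfl

instance : IsScalarTower ℂ (U n) (Fock n) where
  smul_assoc a u f := by simp [smul_def]

theorem e_zero_smul (i j : Fin (n + 1)) (f : Fock n) :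
    ι n (e n 0 i j) • f = xOp i (dOp j f) + flip 1 i (flip 0 j f) := by
  rw [smul_def, Oscillators.rep_e]; rfl

theorem e_one_smul (i j : Fin (n + 1)) (f : Fock n) :
    ι n (e n 1 i j) • f = xOp i (flip 0 j f) + flip 1 i (dOp j f) := by
  rw [smul_def, Oscillators.rep_e]; rfl

end Fock

namespace Fock

/-! ### The vacuum and the map from the induced module -/

theorem jw_zero (l : Fin (n + 1) → ZMod 2) : jw 0 l = 1 :=
  Finset.prod_eq_one fun j hj => absurd (Finset.mem_Iio.1 hj) (Fin.not_lt_zero j)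

theorem e_zero_self_smul_apply (i : Fin (n + 1)) (f : Fock n) (k l) :
    (ι n (e n 0 i i) • f) k l = ((k i : ℂ) + (l i).val) * f k l := by
  have h11 : (1 : ZMod 2) + 1 = 0 := by decide
  have hv : (1 : ZMod 2).val = 1 := rfl
  have hl : l + Pi.single i 1 + Pi.single i 1 = l := by
    rw [add_assoc, ← Pi.single_add, h11, Pi.single_zero, add_zero]
  have hc : raiseCoeff i (k i) * lowerCoeff i (k i - 1) = k i := by
    unfold raiseCoeff lowerCoeff; split_ifs <;> simp
  rw [e_zero_smul, add_apply, xOp_apply, dOp_apply, flip_apply, flip_apply, sub_add_cancel,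
    Pi.sub_apply, Pi.single_eq_same, ← mul_assoc, hc, hl, jw_add_single_self, Pi.add_apply,
    Pi.single_eq_same, add_mul]
  rcases zmod_two_cases (l i) with h | h
  · simp [h]
  · simp [h, h11, hv, ← mul_assoc, jw_mul_self]

/-- The Fock vacuum `√p x_0^p + x_0^{p-1} y_0`: in the two-dimensional space of functions of
degree `p` in the mode `0`, it is an eigenvector of `e_{00}^1` for the eigenvalue `√p`. -/
def vacuum (n p : ℕ) : Fock n := fun k l =>
  if ∀ i : Fin n, k i.succ = 0 ∧ l i.succ = 0 then
    if l 0 = 0 then (if k 0 = p then (Real.sqrt p : ℂ) else 0)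
    else (if k 0 = p - 1 then 1 else 0)
  else 0

theorem dOp_vacuum (p : ℕ) (j : Fin n) : dOp j.succ (vacuum n p) = 0 := by
  ext k l
  rw [dOp_apply, vacuum, zero_apply]
  by_cases h : ∀ i : Fin n, (k + Pi.single j.succ 1 : Fin (n + 1) → ℤ) i.succ = 0 ∧ l i.succ = 0
  · have := (h j).1
    rw [Pi.add_apply, Pi.single_eq_same] at this
    rw [lowerCoeff, if_neg j.succ_ne_zero, eq_neg_of_add_eq_zero_left this]
    simp
  · rw [if_neg h, mul_zero]

theorem flip_zero_vacuum (p : ℕ) (j : Fin n) : flip 0 j.succ (vacuum n p) = 0 := by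
  ext k l
  rw [flip_apply, vacuum, zero_apply, ite_eq_right_iff]
  intro h0
  rw [if_neg, mul_zero]
  intro h
  have := (h j).2
  simp [h0] at this

theorem e_succ_smul_vacuum (p : ℕ) (σ : ZMod 2) (i : Fin (n + 1)) (j : Fin n) :
    ι n (e n σ i j.succ) • vacuum n p = 0 := by
  rcases zmod_two_cases σ with rfl | rfl
  · simp [e_zero_smul, dOp_vacuum, flip_zero_vacuum]
  · simp [e_one_smul, dOp_vacuum, flip_zero_vacuum]

theorem e_zero_zero_smul_vacuum (p : ℕ) :
    ι n (e n 0 0 0) • vacuum n p = (p : ℂ) • vacuum n p := by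
  have hv : (1 : ZMod 2).val = 1 := rfl
  ext k l
  rw [e_zero_self_smul_apply, smul_apply, vacuum]
  rcases zmod_two_cases (l 0) with h | h
  · simp only [h]
    split_ifs <;> simp [*]
  · simp only [h]
    split_ifs <;> simp [*]

theorem e_one_zero_smul_vacuum (p : ℕ) :
    ι n (e n 1 0 0) • vacuum n p = (Real.sqrt p : ℂ) • vacuum n p := by
  have h11 : (1 : ZMod 2) + 1 = 0 := by decide
  have h10 : (1 : ZMod 2) ≠ 0 := by decide
  have hp : (Real.sqrt p : ℂ) * Real.sqrt p = p := by
    rw [← Complex.ofReal_mul, Real.mul_self_sqrt (Nat.cast_nonneg p), Complex.ofReal_natCast]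
  ext k l
  rw [e_one_smul, add_apply, xOp_apply, flip_apply, flip_apply, dOp_apply, smul_apply]
  simp only [jw_zero, vacuum, raiseCoeff, lowerCoeff, if_true, one_mul, Pi.add_apply, Pi.sub_apply,
    Pi.single_eq_same, Pi.single_eq_of_ne (Fin.succ_ne_zero _), add_zero, sub_zero]
  rcases zmod_two_cases (l 0) with h | h
  · simp only [h, zero_add, h10, h10.symm, if_true, if_false, sub_left_inj, add_zero]
    by_cases hk : k 0 = p <;> simp [hk, hp]
  · simp only [h, h10, h11, if_true, if_false, zero_add, eq_sub_iff_add_eq, mul_zero]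
    by_cases hk : k 0 + 1 = p <;> simp [hk]

theorem smul_vacuum (p : ℕ) {x : Q n} (hx : x ∈ parabolic n) :
    ι n x • vacuum n p = vacuumChar n p x • vacuum n p := by
  have hsum : ∀ f : ZMod 2 → Fock n, ∑ x, f x = f 0 + f 1 := fun f => Fin.sum_univ_two f
  have hx' : ∀ σ (i : Fin n), x σ i.succ 0 = 0 := hx
  rw [ι_smul_eq_sum]
  simp only [Fin.sum_univ_succ (n := n), e_succ_smul_vacuum, smul_zero, Finset.sum_const_zero,
    add_zero, hx', zero_smul]
  rw [hsum, e_zero_zero_smul_vacuum, e_one_zero_smul_vacuum, smul_smul, smul_smul, ← add_smul,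
    vacuumChar]

/-- The homomorphism from the induced module to the Fock module, given by `v₀ ↦ vacuum`. -/
def ofVbar (n p : ℕ) : Vbar n p →ₗ[U n] Fock n :=
  (vacuumIdeal n p).liftQ (LinearMap.toSpanSingleton (U n) (Fock n) (vacuum n p)) <| by
    rw [vacuumIdeal, Submodule.span_le]
    rintro _ ⟨x, hx, rfl⟩
    simp [sub_smul, smul_vacuum p hx]

theorem ofVbar_vac (p : ℕ) : ofVbar n p (vac n p) = vacuum n p := by
  simp [ofVbar, vac]

end Fock

/-- A module generated by a vector on which the subalgebra `parabolic n` acts as on `ℂ v₀`, with a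
homomorphism to the Fock module carrying this vector to the Fock vacuum. The induced module
satisfies this, and these properties determine all that follows. -/
structure IsInduced (p : ℕ) {W : Type*} [AddCommGroup W] [Module ℂ W] [Module (U n) W]
    (w : W) (Ψ : W →ₗ[U n] Fock n) : Prop where
  eq_top : ∀ N : Submodule (U n) W, w ∈ N → N = ⊤
  smul_eq : ∀ x ∈ parabolic n, ι n x • w = vacuumChar n p x • w
  map_eq : Ψ w = Fock.vacuum n p

theorem isInduced_Vbar (p : ℕ) : IsInduced p (vac n p) (Fock.ofVbar n p) where
  eq_top N h := by
    rw [eq_top_iff]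
    rintro v -
    obtain ⟨u, rfl⟩ := Submodule.mkQ_surjective _ v
    have : (vacuumIdeal n p).mkQ u = u • vac n p := by
      rw [vac, ← map_smul, smul_eq_mul, mul_one]
    rw [this]
    exact N.smul_mem _ h
  smul_eq x hx := by
    have h : ι n x - algebraMap ℂ (U n) (vacuumChar n p x) ∈ vacuumIdeal n p :=
      Submodule.subset_span ⟨x, hx, rfl⟩
    calc ι n x • vac n p = (vacuumIdeal n p).mkQ (ι n x * 1) := rfl
      _ = (vacuumIdeal n p).mkQ (vacuumChar n p x • 1) := by
        rw [mul_one, ← Algebra.algebraMap_eq_smul_one]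
        exact (Submodule.Quotient.eq _).2 h
      _ = vacuumChar n p x • vac n p := rfl
  map_eq := Fock.ofVbar_vac p

section induced

variable {p : ℕ} {W : Type*} [AddCommGroup W] [Module ℂ W] [Module (U n) W]
  {w : W} {Ψ : W →ₗ[U n] Fock n}

theorem IsInduced.e_succ_smul (hw : IsInduced p w Ψ) (σ : ZMod 2) (i : Fin (n + 1)) (j : Fin n) :
    ι n (e n σ i j.succ) • w = 0 := by
  rw [hw.smul_eq]
  · have : vacuumChar n p (e n σ i j.succ) = 0 := by
      rcases zmod_two_cases σ with rfl | rfl <;> simp [vacuumChar, e, hom]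
    rw [this, zero_smul]
  · intro τ a
    rcases eq_or_ne τ σ with rfl | h
    · simp [e, hom]
    · simp [e, hom, h]

theorem IsInduced.e_zero_smul (hw : IsInduced p w Ψ) (σ : ZMod 2) :
    ι n (e n σ 0 0) • w = (if σ = 0 then (p : ℂ) else (Real.sqrt p : ℂ)) • w := by
  have h10 : (1 : ZMod 2) ≠ 0 := by decide
  rw [hw.smul_eq]
  · rcases zmod_two_cases σ with rfl | rfl <;> simp [vacuumChar, e, hom, h10]
  · intro τ a
    rcases eq_or_ne τ σ with rfl | h
    · simp [e, hom, (Fin.succ_ne_zero a).symm]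
    · simp [e, hom, h]

end induced

/-! ### Ordered products -/

section lists

variable {A : Type*} [Ring A] [Algebra ℂ A]

theorem prod_Iio_succ {n : ℕ} (s : Fin (n + 1) → ℂ) (i : Fin n) :
    ∏ j ∈ Finset.Iio i.succ, s j = s 0 * ∏ j ∈ Finset.Iio i, s j.succ := by
  have hI : Finset.Iio i.succ = insert 0 ((Finset.Iio i).map (Fin.succEmb n)) := by
    ext a
    refine Fin.cases ?_ (fun a => ?_) a <;> simp
  rw [hI, Finset.prod_insert (by simp), Finset.prod_map]
  rfl

theorem prod_Iio_zero {n : ℕ} (s : Fin (n + 1) → ℂ) : ∏ j ∈ Finset.Iio 0, s j = 1 :=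
  Finset.prod_eq_one fun j hj => absurd (Finset.mem_Iio.1 hj) (Fin.not_lt_zero j)

/-- Moving `c` to the factor `i` of an ordered product, past factors with which it commutes up to
scalars. -/
theorem mul_prod_ofFn (c : A) : ∀ {n : ℕ} (g : Fin n → A) (s : Fin n → ℂ) (i : Fin n),
    (∀ j < i, c * g j = s j • (g j * c)) →
    c * (List.ofFn g).prod =
      (∏ j ∈ Finset.Iio i, s j) • (List.ofFn (Function.update g i (c * g i))).prod
  | n + 1, g, s, i => by
    have hcons : ∀ h : Fin (n + 1) → A, (List.ofFn h).prod =
      h 0 * (List.ofFn fun j : Fin n => h j.succ).prod := by simp [List.ofFn_succ]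
    intro hc
    refine Fin.cases ?_ ?_ i hc
    · intro _
      rw [hcons, hcons]
      simp [mul_assoc, prod_Iio_zero]
    · intro i hc
      have ih := mul_prod_ofFn c (fun j : Fin n => g j.succ) (fun j => s j.succ) i
        fun j hj => hc _ (Fin.succ_lt_succ_iff.2 hj)
      have hu : (fun j : Fin n => Function.update g i.succ (c * g i.succ) j.succ) =
          Function.update (fun j : Fin n => g j.succ) i (c * g i.succ) := by
        ext j
        rcases eq_or_ne j i with rfl | h <;> simp [*]
      rw [hcons, hcons, prod_Iio_succ, ← mul_assoc,
        hc 0 (Fin.succ_pos _), smul_mul_assoc, mul_assoc, ih, hu,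
        Function.update_of_ne (Fin.succ_ne_zero i).symm]
      simp [smul_smul]

/-- The twisted Leibniz rule: `c` passes each factor `g j` up to the scalar `s j`, leaving a term
where `g j` is replaced by `d j`. -/
theorem mul_prod_ofFn_leibniz (c : A) : ∀ {n : ℕ} (g d : Fin n → A) (s : Fin n → ℂ),
    (∀ j, c * g j = s j • (g j * c) + d j) →
    c * (List.ofFn g).prod = (∏ j, s j) • ((List.ofFn g).prod * c) +
      ∑ i, (∏ j ∈ Finset.Iio i, s j) • (List.ofFn (Function.update g i (d i))).prod
  | 0, g, d, s => by simp
  | n + 1, g, d, s => by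
    have hcons : ∀ h : Fin (n + 1) → A, (List.ofFn h).prod =
      h 0 * (List.ofFn fun j : Fin n => h j.succ).prod := by simp [List.ofFn_succ]
    intro hc
    have ih := mul_prod_ofFn_leibniz c (fun j : Fin n => g j.succ) (fun j => d j.succ)
      (fun j => s j.succ) fun j => hc _
    have hu : ∀ i : Fin n, (fun j : Fin n => Function.update g i.succ (d i.succ) j.succ) =
        Function.update (fun j : Fin n => g j.succ) i (d i.succ) := by
      intro i
      ext j
      rcases eq_or_ne j i with rfl | h <;> simp [*]
    rw [hcons, ← mul_assoc, hc, add_mul, smul_mul_assoc, mul_assoc, ih, Fin.prod_univ_succ,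
      Fin.sum_univ_succ]
    simp only [hcons, hu, prod_Iio_succ, prod_Iio_zero, Function.update_self,
      Function.update_of_ne (Fin.succ_ne_zero _).symm]
    simp [mul_add, smul_smul, Finset.mul_sum, Finset.smul_sum, mul_assoc]
    abel

end lists

/-! ### Monomials in supercommuting creation operators -/

section monomials

variable {A : Type*} [Ring A]

/-- The ordered monomial `b_1^{k_1} f_1^{l_1} ⋯ b_n^{k_n} f_n^{l_n}`. -/
def mon (b f : Fin n → A) (k l : Fin n → ℕ) : A := (List.ofFn fun i => b i ^ k i * f i ^ l i).prod

variable {b f : Fin n → A}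

theorem mon_zero : mon b f 0 0 = 1 := by
  simp [mon]

variable [Algebra ℂ A]

theorem b_mul_mon (hbb : ∀ i j, b i * b j = b j * b i) (hbf : ∀ i j, b i * f j = f j * b i)
    (k l : Fin n → ℕ) (i : Fin n) :
    b i * mon b f k l = mon b f (Function.update k i (k i + 1)) l := by
  have h : ∀ j, b i * (b j ^ k j * f j ^ l j) = (1 : ℂ) • (b j ^ k j * f j ^ l j * b i) := by
    intro j
    rw [one_smul]
    exact (Commute.mul_right (Commute.pow_right (hbb i j) _) (Commute.pow_right (hbf i j) _))
  rw [mon, mul_prod_ofFn (b i) _ (fun _ => 1) i (fun j _ => h j), Finset.prod_const_one, one_smul,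
    mon]
  congr 2
  funext j
  rcases eq_or_ne j i with rfl | hj
  · simp [pow_succ', mul_assoc]
  · simp [hj]

theorem f_mul_pow (hff : ∀ i j, f i * f j = -(f j * f i)) (i j : Fin n) (a : ℕ) :
    f i * f j ^ a = (-1 : ℂ) ^ a • (f j ^ a * f i) := by
  induction a with
  | zero => simp
  | succ a ih =>
    rw [pow_succ, ← mul_assoc, ih, smul_mul_assoc, mul_assoc, hff i j, pow_succ (-1 : ℂ), mul_smul,
      neg_one_smul, mul_neg, mul_assoc]

theorem f_mul_mon (hbf : ∀ i j, b i * f j = f j * b i) (hff : ∀ i j, f i * f j = -(f j * f i))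
    (k l : Fin n → ℕ) (i : Fin n) :
    f i * mon b f k l =
      (∏ j ∈ Finset.Iio i, (-1 : ℂ) ^ l j) • mon b f k (Function.update l i (l i + 1)) := by
  have hc : ∀ j (a : ℕ), f i * b j ^ a = b j ^ a * f i := fun j a =>
    Commute.pow_right (hbf j i).symm a
  have h : ∀ j, f i * (b j ^ k j * f j ^ l j) =
      (-1 : ℂ) ^ l j • (b j ^ k j * f j ^ l j * f i) := by
    intro j
    rw [← mul_assoc, hc, mul_assoc, f_mul_pow hff, mul_smul_comm, mul_assoc]
  rw [mon, mul_prod_ofFn (f i) _ (fun j => (-1 : ℂ) ^ l j) i (fun j _ => h j), mon]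
  congr 3
  funext j
  rcases eq_or_ne j i with rfl | hj
  · simp [pow_succ', ← mul_assoc, hc]
  · simp [hj]

theorem f_mul_self (hff : ∀ i j, f i * f j = -(f j * f i)) (i : Fin n) : f i * f i = 0 := by
  have h2 : (2 : ℂ) • (f i * f i) = 0 := by
    rw [two_smul]
    nth_rw 1 [hff i i]
    exact neg_add_cancel _
  exact (smul_eq_zero_iff_right two_ne_zero).1 h2

theorem mon_eq_zero (hff : ∀ i j, f i * f j = -(f j * f i)) (k l : Fin n → ℕ) (i : Fin n)
    (hi : 2 ≤ l i) : mon b f k l = 0 := by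
  refine List.prod_eq_zero ((List.mem_ofFn' _ _).2 ⟨i, ?_⟩)
  obtain ⟨a, ha⟩ := Nat.exists_eq_add_of_le hi
  simp only [ha, pow_add, pow_two, f_mul_self hff, zero_mul, mul_zero]

/-- An operator `c` with `[c, b_i] = -f_i` and `{c, f_i} = b_i` acts on monomials as
`∑ (b_i ∂/∂f_i - f_i ∂/∂b_i)`, up to the term where it has passed the whole monomial. The truncated
subtractions come with the coefficient `0`. -/
theorem odd_mul_mon {c : A} (hbf : ∀ i j, b i * f j = f j * b i)
    (hff : ∀ i j, f i * f j = -(f j * f i))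
    (hb : ∀ i, c * b i = b i * c - f i)
    (hf : ∀ i, c * f i = -(f i * c) + b i) (k l : Fin n → ℕ) (hl : ∀ i, l i ≤ 1) :
    c * mon b f k l = (∏ j, (-1 : ℂ) ^ l j) • (mon b f k l * c) +
      (∑ i, ((∏ j ∈ Finset.Iio i, (-1 : ℂ) ^ l j) * l i) •
        mon b f (Function.update k i (k i + 1)) (Function.update l i (l i - 1)) -
      ∑ i, ((∏ j ∈ Finset.Iio i, (-1 : ℂ) ^ l j) * (if l i = 0 then 1 else 0) * k i) •
        mon b f (Function.update k i (k i - 1)) (Function.update l i (l i + 1))) := by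
  have hpow : ∀ i (a : ℕ), c * b i ^ a = b i ^ a * c - (a : ℂ) • (b i ^ (a - 1) * f i) := by
    intro i a
    induction a with
    | zero => simp
    | succ a ih =>
      have h1 : b i ^ (a - 1) * f i * b i = if a = 0 then f i * b i else b i ^ a * f i := by
        rcases a with _ | a
        · simp
        · simp [mul_assoc, ← hbf i i, pow_succ]
      rw [pow_succ, ← mul_assoc, ih, sub_mul, mul_assoc (b i ^ a), hb, smul_mul_assoc, h1]
      split_ifs with h0
      · subst h0; simp
      · push_cast
        simp [mul_sub, add_smul, mul_assoc]
        abel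
  set d : Fin n → A := fun i => if l i = 0 then -((k i : ℂ) • (b i ^ (k i - 1) * f i))
    else b i ^ (k i + 1) with hd
  have h : ∀ j, c * (b j ^ k j * f j ^ l j) =
      (-1 : ℂ) ^ l j • (b j ^ k j * f j ^ l j * c) + d j := by
    intro j
    have := hl j
    rcases (show l j = 0 ∨ l j = 1 by omega) with h0 | h1
    · simp [hd, h0, hpow, sub_eq_add_neg]
    · simp only [hd, h1, pow_one, one_ne_zero, if_false, ← mul_assoc, hpow, sub_mul,
        smul_mul_assoc]
      rw [mul_assoc _ (f j) (f j), f_mul_self hff, mul_zero, smul_zero, sub_zero,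
        mul_assoc _ c (f j), hf, mul_add, pow_succ, neg_one_smul, mul_neg, mul_assoc]
  rw [mon, mul_prod_ofFn_leibniz c _ d _ h, ← Finset.sum_sub_distrib]
  congr 1
  refine Finset.sum_congr rfl fun i _ => ?_
  have hu : ∀ (x y : ℕ), mon b f (Function.update k i x) (Function.update l i y) =
      (List.ofFn (Function.update (fun i => b i ^ k i * f i ^ l i) i
        (b i ^ x * f i ^ y))).prod := by
    intro x y
    rw [mon]
    congr 2
    funext j
    rcases eq_or_ne j i with rfl | hj
    · simp
    · simp [hj]
  have hlin : ∀ (a : ℂ) (z : A),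
      (List.ofFn (Function.update (fun i => b i ^ k i * f i ^ l i) i (a • z))).prod =
      a • (List.ofFn (Function.update (fun i => b i ^ k i * f i ^ l i) i z)).prod := by
    intro a z
    simpa only [MultilinearMap.mkPiAlgebraFin_apply] using
      (MultilinearMap.mkPiAlgebraFin ℂ n A).map_update_smul (fun i => b i ^ k i * f i ^ l i) i a z
  have := hl i
  rcases (show l i = 0 ∨ l i = 1 by omega) with h0 | h1
  · simp only [hd, h0, hu, if_true, ← neg_smul, hlin]
    simp [smul_smul]
  · simp [hd, h1, hu]

end monomials

/-! ### The monomial vectors -/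

theorem bPlus_comm (i j : Fin n) : bPlus n i * bPlus n j = bPlus n j * bPlus n i := by
  rw [bPlus, bPlus, ι_e_mul, if_neg (Fin.succ_ne_zero j).symm, if_neg (Fin.succ_ne_zero i),
    sgn_zero_left]
  simp

theorem bPlus_fPlus_comm (i j : Fin n) : bPlus n i * fPlus n j = fPlus n j * bPlus n i := by
  rw [bPlus, fPlus, ι_e_mul, if_neg (Fin.succ_ne_zero j).symm, if_neg (Fin.succ_ne_zero i),
    sgn_zero_left]
  simp

/-- The instance of `neg_one_smul` for `U(G)`, where rewriting with the general lemma does not find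
the scalar action. -/
theorem U_neg_one_smul (u : U n) : (-1 : ℂ) • u = -u := neg_one_smul ℂ u

theorem fPlus_anticomm (i j : Fin n) : fPlus n i * fPlus n j = -(fPlus n j * fPlus n i) := by
  rw [fPlus, fPlus, ι_e_mul, if_neg (Fin.succ_ne_zero j).symm, if_neg (Fin.succ_ne_zero i),
    sgn_one_one, U_neg_one_smul]
  simp

theorem e_one_mul_bPlus (i : Fin n) :
    ι n (e n 1 0 0) * bPlus n i = bPlus n i * ι n (e n 1 0 0) - fPlus n i := by
  rw [bPlus, fPlus, ι_e_mul, if_neg (Fin.succ_ne_zero i).symm, if_pos rfl, sgn_zero_right]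
  simp [sub_eq_add_neg]

theorem e_one_mul_fPlus (i : Fin n) :
    ι n (e n 1 0 0) * fPlus n i = -(fPlus n i * ι n (e n 1 0 0)) + bPlus n i := by
  have h11 : (1 : ZMod 2) + 1 = 0 := by decide
  rw [bPlus, fPlus, ι_e_mul, if_neg (Fin.succ_ne_zero i).symm, if_pos rfl, sgn_one_one, h11,
    U_neg_one_smul, U_neg_one_smul]
  simp

theorem sum_update_add_one (m : Fin n → ℕ) (i : Fin n) :
    ∑ a, Function.update m i (m i + 1) a = ∑ a, m a + 1 := by
  rw [Finset.sum_update_of_mem (Finset.mem_univ i), Finset.sdiff_singleton_eq_erase,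
    ← Finset.add_sum_erase _ _ (Finset.mem_univ i)]
  omega

theorem update_sub_one_add_one (m : Fin n → ℕ) {i : Fin n} (hi : m i ≠ 0) :
    Function.update (Function.update m i (m i - 1)) i
      (Function.update m i (m i - 1) i + 1) = m := by
  funext j
  rcases eq_or_ne j i with rfl | hj
  · simp; omega
  · simp [hj]

/-- Induction on multi-indices, raising one entry by one. -/
theorem multiindex_induction {P : (Fin n → ℕ) → Prop} (zero : P 0)
    (succ : ∀ k i, P k → P (Function.update k i (k i + 1))) (k : Fin n → ℕ) : P k := by
  induction hN : ∑ i, k i generalizing k with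
  | zero =>
    have : k = 0 := by
      funext i
      exact (Finset.sum_eq_zero_iff.1 hN) i (Finset.mem_univ i)
    exact this ▸ zero
  | succ N ih =>
    obtain ⟨i, -, hi⟩ : ∃ i ∈ Finset.univ, k i ≠ 0 := by
      by_contra! h
      rw [Finset.sum_eq_zero h] at hN
      omega
    rw [← update_sub_one_add_one k hi] at hN ⊢
    rw [sum_update_add_one] at hN
    exact succ _ _ (ih _ (Nat.succ_injective hN))

/-- The monomial `(b_1⁺)^{k_1} (f_1⁺)^{l_1} ⋯ (b_n⁺)^{k_n} (f_n⁺)^{l_n}` of creation operators. -/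
abbrev creation (k l : Fin n → ℕ) : U n := mon (bPlus n) (fPlus n) k l

section induced

variable {p : ℕ} {W : Type*} [AddCommGroup W] [Module (U n) W]

theorem bPlus_smul_creation (w : W) (k l : Fin n → ℕ) (i : Fin n) :
    bPlus n i • creation k l • w = creation (Function.update k i (k i + 1)) l • w := by
  rw [smul_smul, b_mul_mon bPlus_comm bPlus_fPlus_comm]

variable [Module ℂ W] [IsScalarTower ℂ (U n) W] {w : W} {Ψ : W →ₗ[U n] Fock n}

theorem fPlus_smul_creation (w : W) (k l : Fin n → ℕ) (i : Fin n) :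
    fPlus n i • creation k l • w = (∏ j ∈ Finset.Iio i, (-1 : ℂ) ^ l j) •
      creation k (Function.update l i (l i + 1)) • w := by
  rw [smul_smul, f_mul_mon bPlus_fPlus_comm fPlus_anticomm, smul_assoc]

theorem creation_smul_update_fermion (w : W) (k l : Fin n → ℕ) (i : Fin n) :
    creation k (Function.update l i (l i + 1)) • w = (∏ j ∈ Finset.Iio i, (-1 : ℂ) ^ l j) •
      fPlus n i • creation k l • w := by
  rw [fPlus_smul_creation, smul_smul, ← Finset.prod_mul_distrib, Finset.prod_eq_one, one_smul]
  intro j _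
  rw [← mul_pow]; simp

/-- The monomials applied to the vacuum span. The point is that `q(n+1)` maps their span into
itself, by induction on the degree: commuting `x` past a creation operator leaves an element of
`q(n+1)` applied to a shorter monomial. -/
theorem IsInduced.span_creation (hw : IsInduced p w Ψ) :
    Submodule.span ℂ {v | ∃ k l : Fin n → ℕ, (∀ i, l i ≤ 1) ∧ v = creation k l • w} = ⊤ := by
  set S := Submodule.span ℂ {v | ∃ k l : Fin n → ℕ, (∀ i, l i ≤ 1) ∧ v = creation k l • w}
    with hS
  have hcr : ∀ σ (i : Fin n), ∀ v ∈ S, ι n (e n σ i.succ 0) • v ∈ S := by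
    intro σ i v hv
    induction hv using Submodule.span_induction with
    | zero => simp
    | add x y _ _ hx hy => rw [smul_add]; exact S.add_mem hx hy
    | smul c x _ hx => rw [U_smul_comm]; exact S.smul_mem c hx
    | mem x hx =>
      obtain ⟨k, l, hl, rfl⟩ := hx
      rcases zmod_two_cases σ with rfl | rfl
      · exact (bPlus_smul_creation w k l i) ▸ Submodule.subset_span ⟨_, l, hl, rfl⟩
      · have h := fPlus_smul_creation w k l i
        rw [fPlus] at h
        rw [h]
        refine S.smul_mem _ ?_
        by_cases h1 : l i = 0
        · refine Submodule.subset_span ⟨k, _, fun j => ?_, rfl⟩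
          rcases eq_or_ne j i with rfl | hj
          · simp [h1]
          · simp [hj, hl j]
        · rw [creation, mon_eq_zero fPlus_anticomm _ _ i, zero_smul]
          · exact S.zero_mem
          · rw [Function.update_self]; omega
  have h0 : w ∈ S := by
    refine Submodule.subset_span ⟨0, 0, by simp, ?_⟩
    rw [creation, mon_zero, one_smul]
  -- The vectors of `S` that `q(n+1)` maps into `S` are stable under creation operators.
  have hstep : ∀ v ∈ S, (∀ σ i j, ι n (e n σ i j) • v ∈ S) → ∀ τ (a : Fin n) σ i j,
      ι n (e n σ i j) • ι n (e n τ a.succ 0) • v ∈ S := by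
    intro v hv h τ a σ i j
    rw [e_smul_e_smul]
    refine S.add_mem (S.smul_mem _ (hcr _ _ _ (h _ _ _))) (S.sub_mem ?_ (S.smul_mem _ ?_)) <;>
      split_ifs
    · exact h _ _ _
    · exact S.zero_mem
    · exact h _ _ _
    · exact S.zero_mem
  have hall : ∀ l k : Fin n → ℕ, creation k l • w ∈ S ∧
      ∀ σ i j, ι n (e n σ i j) • creation k l • w ∈ S := by
    intro l
    induction l using multiindex_induction with
    | zero =>
      intro k
      induction k using multiindex_induction with
      | zero =>
        rw [creation, mon_zero, one_smul]
        refine ⟨h0, fun σ i j => ?_⟩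
        refine Fin.cases ?_ (fun j => ?_) j
        · refine Fin.cases ?_ (fun i => ?_) i
          · rw [hw.e_zero_smul]; exact S.smul_mem _ h0
          · exact hcr σ i w h0
        · rw [hw.e_succ_smul]; exact S.zero_mem
      | succ k i ih =>
        rw [← bPlus_smul_creation]
        exact ⟨hcr 0 i _ ih.1, hstep _ ih.1 ih.2 0 i⟩
    | succ l i ih =>
      intro k
      rw [creation_smul_update_fermion]
      refine ⟨S.smul_mem _ (hcr 1 i _ (ih k).1), fun σ a b => ?_⟩
      rw [U_smul_comm]
      exact S.smul_mem _ (hstep _ (ih k).1 (ih k).2 1 i σ a b)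
  have hstab : ∀ σ i j, ∀ v ∈ S, ι n (e n σ i j) • v ∈ S := by
    intro σ i j v hv
    induction hv using Submodule.span_induction with
    | zero => simp
    | add x y _ _ hx hy => rw [smul_add]; exact S.add_mem hx hy
    | smul c x _ hx => rw [U_smul_comm]; exact S.smul_mem c hx
    | mem x hx =>
      obtain ⟨k, l, -, rfl⟩ := hx
      exact (hall l k).2 σ i j
  let N : Submodule (U n) W :=
    { S.toAddSubmonoid with smul_mem' := fun u v hv => smul_mem_of_e S hstab u v hv }
  have hN : N = ⊤ := hw.eq_top N h0
  rw [eq_top_iff]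
  intro v _
  have : v ∈ N := hN ▸ Submodule.mem_top
  exact this

theorem lam_zero (p : ℕ) : lam p (0 : Fin n → ℕ) = Pi.single 0 (p : ℂ) := by
  funext i
  refine Fin.cases ?_ (fun i => ?_) i <;> simp [lam]

theorem lam_update_add_one (p : ℕ) (m : Fin n → ℕ) (i : Fin n) :
    lam p (Function.update m i (m i + 1)) = lam p m + Pi.single i.succ 1 - Pi.single 0 1 := by
  funext j
  refine Fin.cases ?_ (fun j => ?_) j
  · have h : ∑ a, (Function.update m i (m i + 1) a : ℂ) = ∑ a, (m a : ℂ) + 1 := by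
      exact_mod_cast sum_update_add_one m i
    simp only [lam, Fin.cons_zero, h, Pi.sub_apply, Pi.add_apply, Pi.single_eq_same,
      Pi.single_eq_of_ne (Fin.succ_ne_zero i).symm]
    ring
  · rcases eq_or_ne j i with rfl | hj
    · simp [lam]
    · simp [lam, hj]

theorem lam_injective (p : ℕ) : Function.Injective (lam p : (Fin n → ℕ) → Fin (n + 1) → ℂ) := by
  intro m m' h
  funext i
  have := congrFun h i.succ
  simpa [lam] using this

theorem IsInduced.creation_mem_weightSpace (hw : IsInduced p w Ψ) (l : Fin n → ℕ) :
    ∀ k : Fin n → ℕ, creation k l • w ∈ weightSpace W (lam p (k + l)) := by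
  have hadd : ∀ (k l : Fin n → ℕ) i, Function.update k i (k i + 1) + l =
      Function.update (k + l) i ((k + l) i + 1) := by
    intro k l i
    funext j
    rcases eq_or_ne j i with rfl | hj
    · simp [add_right_comm]
    · simp [hj]
  induction l using multiindex_induction with
  | zero =>
    intro k
    induction k using multiindex_induction with
    | zero =>
      rw [creation, mon_zero, one_smul, add_zero, lam_zero]
      intro i
      refine Fin.cases ?_ (fun i => ?_) i
      · rw [hw.e_zero_smul, if_pos rfl, Pi.single_eq_same]
      · rw [hw.e_succ_smul, Pi.single_eq_of_ne (Fin.succ_ne_zero i), zero_smul]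
    | succ k i ih =>
      rw [← bPlus_smul_creation, hadd, lam_update_add_one]
      exact e_smul_mem_weightSpace 0 i.succ 0 ih
  | succ l i ih =>
    intro k
    rw [creation_smul_update_fermion, add_comm k, hadd, add_comm l, lam_update_add_one]
    exact Submodule.smul_mem _ _ (e_smul_mem_weightSpace 1 i.succ 0 (ih k))

end induced

namespace Fock

/-! ### Linear independence of the monomial vectors -/

/-- The coefficient of `x_0^a y_0 x^k y^l`, where `a` makes the total degree `p`. The terms of
`b_i⁺` and `f_i⁺` that annihilate `y_0` do not contribute, so that on these coefficients the
creation operators act as `x_i` and `± y_i` alone. -/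
def slice (p : ℕ) (k : Fin n → ℤ) (l : Fin n → ZMod 2) : Fock n →ₗ[ℂ] ℂ where
  toFun f := f (Fin.cons (p - 1 - ∑ i, k i - ∑ i, ((l i).val : ℤ)) k) (Fin.cons 1 l)
  map_add' _ _ := rfl
  map_smul' _ _ := rfl

theorem slice_apply (p : ℕ) (k : Fin n → ℤ) (l : Fin n → ZMod 2) (f : Fock n) : slice p k l f =
    f (Fin.cons (p - 1 - ∑ i, k i - ∑ i, ((l i).val : ℤ)) k) (Fin.cons 1 l) := rfl

theorem slice_bPlus_smul (p : ℕ) (k : Fin n → ℤ) (l : Fin n → ZMod 2) (i : Fin n) (f : Fock n) :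
    slice p k l (bPlus n i • f) = slice p (k - Pi.single i 1) l f := by
  have h10 : (1 : ZMod 2) ≠ 0 := by decide
  rw [bPlus, e_zero_smul, slice_apply, slice_apply, add_apply, xOp_apply, dOp_apply, flip_apply,
    flip_apply]
  simp only [Pi.add_apply, Fin.cons_zero, Pi.single_eq_of_ne (Fin.succ_ne_zero i).symm, add_zero,
    h10, if_false, mul_zero, ite_self, raiseCoeff, lowerCoeff, Fin.succ_ne_zero, if_true, one_mul]
  congr 1
  funext j
  refine Fin.cases ?_ (fun j => ?_) j
  · simp [Finset.sum_sub_distrib, (Fin.succ_ne_zero i).symm]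
    ring
  · simp [Pi.single_apply]

theorem slice_fPlus_smul (p : ℕ) (k : Fin n → ℤ) (l : Fin n → ZMod 2) (i : Fin n) (f : Fock n) :
    slice p k l (fPlus n i • f) =
      if l i = 1 then jw i.succ (Fin.cons 1 l) * slice p k (l + Pi.single i 1) f else 0 := by
  have h10 : (1 : ZMod 2) ≠ 0 := by decide
  have h11 : (1 : ZMod 2) + 1 = 0 := by decide
  have hv : (1 : ZMod 2).val = 1 := rfl
  rw [fPlus, e_one_smul, slice_apply, slice_apply, add_apply, xOp_apply, flip_apply, flip_apply,
    dOp_apply]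
  simp only [Fin.cons_zero, h10, if_false, mul_zero, lowerCoeff, if_true, one_mul, zero_add,
    Fin.cons_succ]
  split_ifs with hl
  · congr 2
    · funext j
      refine Fin.cases ?_ (fun j => ?_) j
      · have hs : ∑ j, ((l j).val : ℤ) =
            ∑ j, (((l + Pi.single i 1 : Fin n → ZMod 2) j).val : ℤ) + 1 := by
          have : ∀ j, ((l j).val : ℤ) =
              ((l + Pi.single i 1 : Fin n → ZMod 2) j).val + if j = i then 1 else 0 := by
            intro j
            rcases eq_or_ne j i with rfl | hj
            · simp [hl, h11, hv]
            · simp [hj]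
          simp_rw [this, Finset.sum_add_distrib]
          simp
        simp only [Pi.add_apply, Fin.cons_zero, Pi.single_eq_same]
        rw [hs]
        simp only [Pi.add_apply]
        ring
      · simp
    · funext j
      refine Fin.cases ?_ (fun j => ?_) j
      · simp [(Fin.succ_ne_zero i).symm]
      · simp [Pi.single_apply]
  · rfl

/-- In terms of the coefficients `slice`, the image of a monomial vector is a nonzero multiple of
one single monomial. -/
theorem slice_creation_ne_zero_iff (p : ℕ) (l : Fin n → ℕ) (hl : ∀ i, l i ≤ 1) :
    ∀ (k : Fin n → ℕ) (k' : Fin n → ℤ) (l' : Fin n → ZMod 2),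
      slice p k' l' (creation k l • vacuum n p) ≠ 0 ↔
        k' = (fun i => (k i : ℤ)) ∧ l' = fun i => (l i : ZMod 2) := by
  have h10 : (1 : ZMod 2) ≠ 0 := by decide
  have h11 : (1 : ZMod 2) + 1 = 0 := by decide
  induction l using multiindex_induction with
  | zero =>
    intro k
    induction k using multiindex_induction with
    | zero =>
      intro k' l'
      rw [creation, mon_zero, one_smul, slice_apply, vacuum]
      simp only [Fin.cons_succ, Fin.cons_zero, h10, if_false]
      by_cases h : ∀ i, k' i = 0 ∧ l' i = 0
      · simp [h, funext_iff]
      · rw [if_neg h]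
        simpa [funext_iff, forall_and] using h
    | succ k i ih =>
      intro k' l'
      rw [← bPlus_smul_creation, slice_bPlus_smul, ih, and_congr_left_iff, sub_eq_iff_eq_add]
      intro _
      have : (fun i => (k i : ℤ)) + Pi.single i 1 =
          fun a => ((Function.update k i (k i + 1) a : ℕ) : ℤ) := by
        funext j
        rcases eq_or_ne j i with rfl | hj <;> simp [*]
      rw [this]
  | succ l i ih =>
    have hli : l i = 0 := by
      have := hl i
      rw [Function.update_self] at this
      omega
    have hl' : ∀ j, l j ≤ 1 := by
      intro j
      rcases eq_or_ne j i with rfl | hj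
      · omega
      · simpa [hj] using hl j
    intro k k' l'
    have hsgn : (∏ j ∈ Finset.Iio i, (-1 : ℂ) ^ l j) ≠ 0 :=
      Finset.prod_ne_zero_iff.2 fun j _ => pow_ne_zero _ (by norm_num)
    rw [creation_smul_update_fermion, map_smul, smul_eq_mul, mul_ne_zero_iff, slice_fPlus_smul,
      and_iff_right hsgn]
    have hiff : l' = (fun a => ((Function.update l i (l i + 1) a : ℕ) : ZMod 2)) ↔
        l' i = 1 ∧ l' + Pi.single i 1 = fun a => (l a : ZMod 2) := by
      simp only [funext_iff]
      constructor
      · intro h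
        refine ⟨by simpa [hli] using h i, fun a => ?_⟩
        rcases eq_or_ne a i with rfl | ha
        · simp [h, hli, h11]
        · simp [h, ha]
      · rintro ⟨h1, h2⟩ a
        rcases eq_or_ne a i with rfl | ha
        · simp [h1, hli]
        · simpa [ha] using h2 a
    rw [hiff]
    split_ifs with h
    · rw [mul_ne_zero_iff, and_iff_right (jw_ne_zero _ _), ih hl']
      simp [h]
    · simp [h]

/-! ### The functions supported on negative powers of `x_0` -/

/-- The functions supported on negative powers of `x_0`. -/
def negativeSubspace (n : ℕ) : Submodule ℂ (Fock n) where
  carrier := {f | ∀ k l, 0 ≤ k 0 → f k l = 0}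
  add_mem' hf hg k l h := by rw [add_apply, hf k l h, hg k l h, add_zero]
  zero_mem' _ _ _ := rfl
  smul_mem' a f hf k l h := by rw [smul_apply, hf k l h, mul_zero]

theorem xOp_mem_negative (i : Fin (n + 1)) {f : Fock n} (hf : f ∈ negativeSubspace n) :
    xOp i f ∈ negativeSubspace n := by
  intro k l h
  rw [xOp_apply]
  rcases eq_or_ne i 0 with rfl | hi
  · rcases h.eq_or_lt with h0 | h0
    · simp [raiseCoeff, ← h0]
    · rw [hf _ _ (by simp; omega), mul_zero]
  · rw [hf _ _ (by simpa [hi.symm] using h), mul_zero]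

theorem dOp_mem_negative (i : Fin (n + 1)) {f : Fock n} (hf : f ∈ negativeSubspace n) :
    dOp i f ∈ negativeSubspace n := by
  intro k l h
  have : (0 : ℤ) ≤ (Pi.single i 1 : Fin (n + 1) → ℤ) 0 := by
    rw [Pi.single_apply]; split_ifs <;> simp
  rw [dOp_apply, hf _ _ (add_nonneg h this), mul_zero]

theorem flip_mem_negative (t : ZMod 2) (i : Fin (n + 1)) {f : Fock n}
    (hf : f ∈ negativeSubspace n) : flip t i f ∈ negativeSubspace n := by
  intro k l h
  rw [flip_apply, hf _ _ h, mul_zero, ite_self]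

/-- The functions supported on negative powers of `x_0` form a submodule, as `x_0` kills
`x_0^{-1}`. -/
def negative (n : ℕ) : Submodule (U n) (Fock n) :=
  { (negativeSubspace n).toAddSubmonoid with
    smul_mem' := fun u v hv => smul_mem_of_e (negativeSubspace n) (fun σ i j f hf => by
      rcases zmod_two_cases σ with rfl | rfl
      · rw [e_zero_smul]
        exact add_mem (xOp_mem_negative _ (dOp_mem_negative _ hf))
          (flip_mem_negative _ _ (flip_mem_negative _ _ hf))
      · rw [e_one_smul]
        exact add_mem (xOp_mem_negative _ (flip_mem_negative _ _ hf))
          (flip_mem_negative _ _ (dOp_mem_negative _ hf))) u v hv }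

theorem mem_negative {f : Fock n} : f ∈ negative n ↔ ∀ k l, 0 ≤ k 0 → f k l = 0 := Iff.rfl

theorem mem_negative_of_xOp_zero {f : Fock n} (h : xOp 0 f ∈ negativeSubspace n) :
    f ∈ negativeSubspace n := by
  intro k l hk
  have h1 := h (k + Pi.single 0 1) l (by simp; omega)
  rw [xOp_apply, add_sub_cancel_right, raiseCoeff, if_pos rfl] at h1
  refine (mul_eq_zero.1 h1).resolve_left ?_
  rw [Pi.add_apply, Pi.single_eq_same]
  exact_mod_cast (show k 0 + 1 ≠ 0 by omega)

/-- If all `e_{0i}^σ` map `f` to functions supported on negative powers of `x_0`, then, apart from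
such powers, only the mode `0` occurs in `f`: there are no singular vectors of positive level modulo
`negative n`. -/
theorem apply_eq_zero_of_lower {f : Fock n}
    (hf : ∀ σ (i : Fin n), ι n (e n σ 0 i.succ) • f ∈ negative n) (k) (l)
    (hk : 0 ≤ k 0) (i : Fin n) (hi : k i.succ ≠ 0 ∨ l i.succ ≠ 0) : f k l = 0 := by
  have h11 : (1 : ZMod 2) + 1 = 0 := by decide
  have h0 : xOp 0 (dOp i.succ f) + flip 1 0 (flip 0 i.succ f) ∈ negativeSubspace n :=
    e_zero_smul 0 i.succ f ▸ hf 0 i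
  have h1 : xOp 0 (flip 0 i.succ f) + flip 1 0 (dOp i.succ f) ∈ negativeSubspace n :=
    e_one_smul 0 i.succ f ▸ hf 1 i
  -- `x_0 (x_0 d_i + y_0 c_i) - y_0 (x_0 c_i + y_0 d_i) = x_0² d_i`
  have hd : dOp i.succ f ∈ negativeSubspace n := by
    refine mem_negative_of_xOp_zero (mem_negative_of_xOp_zero ?_)
    have h2 := sub_mem (xOp_mem_negative 0 h0) (flip_mem_negative 1 0 h1)
    have hyx : ∀ g : Fock n, flip 1 0 (xOp 0 g) = xOp 0 (flip 1 0 g) := fun g =>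
      LinearMap.congr_fun ((osc n).yx 0 0) g
    have hyy : ∀ g : Fock n, flip 1 0 (flip 1 0 g) = 0 := fun g =>
      LinearMap.congr_fun (flip_flip_self 1 0) g
    rw [map_add, map_add, hyx, hyy, add_zero, add_sub_cancel_right] at h2
    exact h2
  have hc : flip 0 i.succ f ∈ negativeSubspace n := by
    refine mem_negative_of_xOp_zero ?_
    have h2 := sub_mem h1 (flip_mem_negative 1 0 hd)
    rwa [add_sub_cancel_right] at h2
  rcases hi with hi | hi
  · have h2 := hd (k - Pi.single i.succ 1) l (by simpa [(Fin.succ_ne_zero i).symm] using hk)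
    rw [dOp_apply, sub_add_cancel] at h2
    refine (mul_eq_zero.1 h2).resolve_left ?_
    simpa [lowerCoeff] using hi
  · have hl : l i.succ = 1 := (zmod_two_cases _).resolve_left hi
    have h2 := hc k (l + Pi.single i.succ 1) hk
    rw [flip_apply, if_pos (by simp [hl, h11]), add_assoc, ← Pi.single_add, h11, Pi.single_zero,
      add_zero] at h2
    exact (mul_eq_zero.1 h2).resolve_left (jw_ne_zero _ _)

end Fock

/-! ### The basis and the weight spaces -/

/-- The labels `(k, l)` of the basis vectors: `l` takes values in `{0, 1}`. -/
abbrev Idx (n : ℕ) : Type := {kl : (Fin n → ℕ) × (Fin n → ℕ) // ∀ i, kl.2 i ≤ 1}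

section induced

variable {p : ℕ} {W : Type*} [AddCommGroup W] [Module ℂ W] [Module (U n) W]
  {w : W} {Ψ : W →ₗ[U n] Fock n}

theorem IsInduced.vacuum_notMem (hw : IsInduced p w Ψ) (hp : 0 < p) :
    w ∉ (Fock.negative n).comap Ψ := by
  intro h
  rw [Submodule.mem_comap, hw.map_eq, Fock.mem_negative] at h
  have := h (Pi.single 0 (p : ℤ)) 0 (by simp)
  simp [Fock.vacuum, hp.ne'] at this

theorem IsInduced.comap_negative_ne_top (hw : IsInduced p w Ψ) (hp : 0 < p) :
    (Fock.negative n).comap Ψ ≠ ⊤ :=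
  fun h => hw.vacuum_notMem hp (h ▸ Submodule.mem_top)

variable [IsScalarTower ℂ (U n) W]

/-- A functional that detects, up to a nonzero factor, the coefficient of the basis vector `a`. -/
def IsInduced.coeff (_ : IsInduced p w Ψ) (a : Idx n) : W →ₗ[ℂ] ℂ :=
  (Fock.slice p (fun i => (a.1.1 i : ℤ)) (fun i => (a.1.2 i : ZMod 2))).comp
    (Ψ.restrictScalars ℂ)

theorem IsInduced.coeff_ne_zero_iff (hw : IsInduced p w Ψ) (a c : Idx n) :
    hw.coeff a (creation c.1.1 c.1.2 • w) ≠ 0 ↔ a = c := by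
  have h : hw.coeff a (creation c.1.1 c.1.2 • w) =
      Fock.slice p (fun i => (a.1.1 i : ℤ)) (fun i => (a.1.2 i : ZMod 2))
        (creation c.1.1 c.1.2 • Fock.vacuum n p) := by
    rw [← hw.map_eq, ← map_smul]; rfl
  rw [h, Fock.slice_creation_ne_zero_iff p _ c.2]
  constructor
  · rintro ⟨h1, h2⟩
    refine Subtype.ext (Prod.ext ?_ ?_)
    · funext i
      exact_mod_cast congrFun h1 i
    · funext i
      have h3 := congrFun h2 i
      have ha := a.2 i
      have hc := c.2 i
      rw [ZMod.natCast_eq_natCast_iff'] at h3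
      rwa [Nat.mod_eq_of_lt (by omega), Nat.mod_eq_of_lt (by omega)] at h3
  · rintro rfl
    exact ⟨rfl, rfl⟩

/-- The basis of monomial vectors. -/
def IsInduced.basis (hw : IsInduced p w Ψ) : Module.Basis (Idx n) ℂ W :=
  Module.Basis.mk (v := fun a : Idx n => creation a.1.1 a.1.2 • w)
    (by
      rw [linearIndependent_iff']
      intro s g hg a ha
      have h := congrArg (hw.coeff a) hg
      rw [map_sum, map_zero, Finset.sum_eq_single a] at h
      · rw [map_smul, smul_eq_mul] at h
        exact (mul_eq_zero.1 h).resolve_right ((hw.coeff_ne_zero_iff a a).2 rfl)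
      · intro c _ hca
        rw [map_smul, not_not.1 (mt (hw.coeff_ne_zero_iff a c).1 hca.symm), smul_zero]
      · exact fun h => absurd ha h)
    (by
      rw [← hw.span_creation, Submodule.span_le]
      rintro _ ⟨k, l, hl, rfl⟩
      exact Submodule.subset_span ⟨⟨(k, l), hl⟩, rfl⟩)

theorem IsInduced.basis_apply (hw : IsInduced p w Ψ) (a : Idx n) :
    hw.basis a = creation a.1.1 a.1.2 • w := by
  simp [basis]

theorem IsInduced.injective (hw : IsInduced p w Ψ) : Function.Injective Ψ := by
  rw [injective_iff_map_eq_zero]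
  intro v hv
  have key : ∀ a (x : W), hw.coeff a x = hw.basis.repr x a * hw.coeff a (hw.basis a) := by
    intro a x
    have : hw.coeff a = (hw.coeff a (hw.basis a)) • hw.basis.coord a := by
      refine hw.basis.ext fun c => ?_
      rcases eq_or_ne a c with rfl | hac
      · simp
      · have := not_not.1 (mt (hw.coeff_ne_zero_iff a c).1 hac)
        rw [← hw.basis_apply] at this
        simp [this, hac.symm]
    conv_lhs => rw [this]
    simp [mul_comm]
  refine hw.basis.ext_elem fun a => ?_
  have h0 : hw.coeff a v = 0 := by
    simp [coeff, hv]
  rw [key] at h0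
  rw [map_zero, Finsupp.zero_apply]
  refine (mul_eq_zero.1 h0).resolve_right ?_
  rw [hw.basis_apply]
  exact (hw.coeff_ne_zero_iff a a).2 rfl

theorem IsInduced.weightSpace_eq_span (hw : IsInduced p w Ψ) (μ : Fin (n + 1) → ℂ) :
    weightSpace W μ =
      Submodule.span ℂ (hw.basis '' {a : Idx n | lam p (a.1.1 + a.1.2) = μ}) :=
  QFock.weightSpace_eq_span hw.basis (fun a => lam p (a.1.1 + a.1.2))
    (fun a => by rw [hw.basis_apply]; exact hw.creation_mem_weightSpace _ _) μ

theorem IsInduced.weightSpace_ne_bot_iff (hw : IsInduced p w Ψ) (μ : Fin (n + 1) → ℂ) :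
    weightSpace W μ ≠ ⊥ ↔ ∃ m : Fin n → ℕ, μ = lam p m := by
  constructor
  · intro h
    by_contra! hm
    refine h ?_
    rw [hw.weightSpace_eq_span, Set.eq_empty_of_forall_notMem (s := {a : Idx n | _})]
    · simp
    · exact fun a ha => hm _ (Eq.symm ha)
  · rintro ⟨m, rfl⟩ h
    have h1 : hw.basis ⟨(m, 0), by simp⟩ ∈ weightSpace W (lam p m) := by
      rw [hw.basis_apply]
      simpa using hw.creation_mem_weightSpace 0 m
    rw [h, Submodule.mem_bot] at h1
    exact hw.basis.ne_zero _ h1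

/-- An enumeration of the basis vectors of weight `λ_m`. -/
def idxOfWeight (m : Fin n → ℕ) (l : Finset.Iic (fun i => min 1 (m i))) : Idx n :=
  ⟨(m - l.1, l.1), fun i => (Finset.mem_Iic.1 l.2 i).trans (min_le_left _ _)⟩

theorem idxOfWeight_injective (m : Fin n → ℕ) : Function.Injective (idxOfWeight m) := by
  intro l l' h
  exact Subtype.ext (congrArg (fun a : Idx n => a.1.2) h)

theorem range_idxOfWeight (m : Fin n → ℕ) :
    Set.range (idxOfWeight m) = {a : Idx n | lam p (a.1.1 + a.1.2) = lam p m} := by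
  ext a
  rw [Set.mem_ofPred_eq, (lam_injective p).eq_iff]
  constructor
  · rintro ⟨l, rfl⟩
    funext i
    have := (Finset.mem_Iic.1 l.2 i).trans (min_le_right _ _)
    simpa [idxOfWeight] using Nat.sub_add_cancel this
  · intro h
    have h1 : ∀ i, a.1.1 i + a.1.2 i = m i := fun i => congrFun h i
    refine ⟨⟨a.1.2, Finset.mem_Iic.2 fun i => le_min (a.2 i) ?_⟩, ?_⟩
    · exact (Nat.le_add_left _ _).trans_eq (h1 i)
    · refine Subtype.ext (Prod.ext ?_ rfl)
      funext i
      have := h1 i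
      simp only [idxOfWeight, Pi.sub_apply]
      omega

theorem IsInduced.weightSpace_lam (hw : IsInduced p w Ψ) (m : Fin n → ℕ) :
    weightSpace W (lam p m) = Submodule.span ℂ (Set.range (hw.basis ∘ idxOfWeight m)) := by
  rw [hw.weightSpace_eq_span, ← range_idxOfWeight, Set.range_comp]

theorem IsInduced.finrank_weightSpace (hw : IsInduced p w Ψ) (m : Fin n → ℕ) :
    Module.finrank ℂ (weightSpace W (lam p m)) = 2 ^ numNonzero m := by
  rw [hw.weightSpace_lam, finrank_span_eq_card
    (hw.basis.linearIndependent.comp _ (idxOfWeight_injective m)), Fintype.card_coe, Pi.card_Iic,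
    numNonzero, Finset.card_filter, ← Finset.prod_pow_eq_pow_sum]
  refine Finset.prod_congr rfl fun i _ => ?_
  rw [Nat.card_Iic]
  split_ifs with h
  · rw [min_eq_left (Nat.one_le_iff_ne_zero.2 h)]; rfl
  · rw [not_not.1 h]; rfl

theorem IsInduced.finite_weightSpace (hw : IsInduced p w Ψ) (m : Fin n → ℕ) :
    Module.Finite ℂ (weightSpace W (lam p m)) := by
  rw [hw.weightSpace_lam]
  exact Module.Finite.span_of_finite ℂ (Set.finite_range _)

theorem IsInduced.iSup_weightSpace (hw : IsInduced p w Ψ) :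
    ⨆ m : Fin n → ℕ, weightSpace W (lam p m) = ⊤ := by
  rw [eq_top_iff, ← hw.span_creation, Submodule.span_le]
  rintro _ ⟨k, l, -, rfl⟩
  exact Submodule.mem_iSup_of_mem (k + l) (hw.creation_mem_weightSpace l k)

theorem IsInduced.exists_weight_decomposition (hw : IsInduced p w Ψ) (v : W) :
    ∃ (s : Finset (Fin n → ℕ)) (f : (Fin n → ℕ) → W),
      (∀ m, f m ∈ weightSpace W (lam p m)) ∧ v = ∑ m ∈ s, f m := by
  have hv : v ∈ ⨆ m : Fin n → ℕ, weightSpace W (lam p m) :=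
    hw.iSup_weightSpace ▸ Submodule.mem_top
  obtain ⟨f, hf, rfl⟩ := (Submodule.mem_iSup_iff_exists_finsupp _ _).1 hv
  exact ⟨f.support, f, hf, rfl⟩

/-- Every submodule is the sum of its weight spaces. -/
theorem IsInduced.iSup_inf_weightSpace (hw : IsInduced p w Ψ) (N : Submodule (U n) W) :
    ⨆ m : Fin n → ℕ, N.restrictScalars ℂ ⊓ weightSpace W (lam p m) = N.restrictScalars ℂ := by
  refine le_antisymm (iSup_le fun m => inf_le_left) fun v hv => ?_
  obtain ⟨s, f, hf, rfl⟩ := hw.exists_weight_decomposition v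
  have h := weight_component_mem N (lam p) (lam_injective p) s f (fun m _ => hf m) hv
  exact Submodule.sum_mem _ fun m hm => Submodule.mem_iSup_of_mem m ⟨h m hm, hf m⟩

/-- The image of a vector of weight `λ_m` is supported on monomials of degree `m_i` in the modes
`i ≥ 1` and of degree `p - level m` in the mode `0`. -/
theorem IsInduced.weight_of_apply_ne_zero {m : Fin n → ℕ} {v : W}
    (hv : v ∈ weightSpace W (lam p m)) {k l} (h : Ψ v k l ≠ 0) :
    k 0 + (l 0).val = p - level m ∧ ∀ i : Fin n, k i.succ + (l i.succ).val = m i := by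
  have key : ∀ i, (k i : ℂ) + (l i).val = lam p m i := by
    intro i
    have h1 := congrArg Ψ (hv i)
    rw [map_smul, LinearMap.map_smul_of_tower] at h1
    have h2 : (ι n (e n 0 i i) • Ψ v) k l = (lam p m i • Ψ v) k l := by rw [h1]
    rw [Fock.e_zero_self_smul_apply, Fock.smul_apply] at h2
    exact mul_right_cancel₀ h h2
  constructor
  · have := key 0
    simp only [lam, Fin.cons_zero] at this
    rw [level]
    exact_mod_cast this
  · intro i
    have := key i.succ
    simp only [lam, Fin.cons_succ] at this
    exact_mod_cast this

/-! ### The maximal submodule -/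

/-- A proper submodule maps into the functions supported on negative powers of `x_0`. By induction
on the level of a weight vector `v`: its images under the `e_{0i}^σ` have smaller level, and
`Fock.apply_eq_zero_of_lower` applies. At level `0` a nonzero `v` would generate everything. -/
theorem IsInduced.le_comap_negative (hw : IsInduced p w Ψ) {N : Submodule (U n) W} (hN : N ≠ ⊤) :
    N ≤ (Fock.negative n).comap Ψ := by
  have hwN : w ∉ N := fun h => hN (hw.eq_top N h)
  have key : ∀ (d : ℕ) (m : Fin n → ℕ), level m = d → ∀ v ∈ N, v ∈ weightSpace W (lam p m) →
      v ∈ (Fock.negative n).comap Ψ := by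
    intro d
    induction d with
    | zero =>
      intro m hm v hvN hv
      have hm0 : m = 0 := by
        funext i
        exact (Finset.sum_eq_zero_iff.1 hm) i (Finset.mem_univ i)
      subst hm0
      have hset : {a : Idx n | lam p (a.1.1 + a.1.2) = lam p 0} = {⟨(0, 0), by simp⟩} := by
        ext a
        rw [Set.mem_ofPred_eq, (lam_injective p).eq_iff, Set.mem_singleton_iff, Subtype.ext_iff,
          Prod.ext_iff, add_eq_zero]
      rw [hw.weightSpace_eq_span, hset, Set.image_singleton, Submodule.mem_span_singleton,
        hw.basis_apply] at hv
      obtain ⟨c, rfl⟩ := hv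
      rw [creation, mon_zero, one_smul] at hvN ⊢
      rcases eq_or_ne c 0 with rfl | hc
      · rw [zero_smul]; exact Submodule.zero_mem _
      · have := N.smul_of_tower_mem c⁻¹ hvN
        rw [smul_smul, inv_mul_cancel₀ hc, one_smul] at this
        exact absurd this hwN
    | succ d ih =>
      intro m hm v hvN hv
      have hlow : ∀ σ (i : Fin n), ι n (e n σ 0 i.succ) • Ψ v ∈ Fock.negative n := by
        intro σ i
        rw [← map_smul]
        have h1 := e_smul_mem_weightSpace σ 0 i.succ hv
        by_cases h0 : ι n (e n σ 0 i.succ) • v = 0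
        · rw [h0, map_zero]; exact Submodule.zero_mem _
        · obtain ⟨m', hm'⟩ := (hw.weightSpace_ne_bot_iff _).1
            (fun hb => h0 (by rwa [hb, Submodule.mem_bot] at h1))
          refine ih m' ?_ _ (N.smul_mem _ hvN) (hm' ▸ h1)
          have h2 := congrFun hm' 0
          simp only [lam, Pi.add_apply, Pi.sub_apply, Fin.cons_zero, Pi.single_eq_same,
            Pi.single_eq_of_ne (Fin.succ_ne_zero i).symm] at h2
          have h3 : ((level m' + 1 : ℕ) : ℂ) = (level m : ℕ) := by
            simp only [level]
            push_cast
            linear_combination h2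
          have h4 : level m' + 1 = level m := by exact_mod_cast h3
          omega
      rw [Submodule.mem_comap, Fock.mem_negative]
      intro k l hk
      by_contra hne
      obtain ⟨-, h1⟩ := IsInduced.weight_of_apply_ne_zero hv hne
      obtain ⟨i, -, hi⟩ : ∃ i ∈ Finset.univ, m i ≠ 0 :=
        Finset.exists_ne_zero_of_sum_ne_zero (s := Finset.univ) (f := m)
          (by rw [level] at hm; omega)
      refine hne (Fock.apply_eq_zero_of_lower hlow k l hk i ?_)
      by_contra! h0
      have := h1 i
      rw [h0.1, h0.2, ZMod.val_zero] at this
      exact hi (by exact_mod_cast this.symm)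
  intro v hv
  obtain ⟨s, f, hf, rfl⟩ := hw.exists_weight_decomposition v
  have h := weight_component_mem N (lam p) (lam_injective p) s f (fun m _ => hf m) hv
  exact Submodule.sum_mem _ fun m hm => key _ m rfl _ (h m hm) (hf m)

theorem IsInduced.sSup_eq (hw : IsInduced p w Ψ) (hp : 0 < p) :
    sSup {N : Submodule (U n) W | N ≠ ⊤} = (Fock.negative n).comap Ψ :=
  le_antisymm (sSup_le fun _ hN => hw.le_comap_negative hN)
    (le_sSup (hw.comap_negative_ne_top hp))

theorem IsInduced.mem_of_lt_level {m : Fin n → ℕ} (hm : p < level m) {v : W}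
    (hv : v ∈ weightSpace W (lam p m)) : v ∈ (Fock.negative n).comap Ψ := by
  rw [Submodule.mem_comap, Fock.mem_negative]
  intro k l hk
  by_contra hne
  have := (IsInduced.weight_of_apply_ne_zero hv hne).1
  omega

theorem IsInduced.notMem_of_level_lt (hw : IsInduced p w Ψ) {m : Fin n → ℕ} (hm : level m < p)
    {v : W} (hv : v ∈ weightSpace W (lam p m)) (h0 : v ≠ 0) : v ∉ (Fock.negative n).comap Ψ := by
  intro h
  refine h0 (hw.injective ?_)
  rw [map_zero]
  ext k l
  by_contra hne
  have h1 := (IsInduced.weight_of_apply_ne_zero hv hne).1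
  have h2 : (l 0).val < 2 := ZMod.val_lt _
  exact hne (h k l (by omega))

/-- At level `p` the maximal submodule is the kernel of `e_{00}^1`: the image of `v` is supported on
`x_0^0` and `x_0^{-1} y_0`, and `e_{00}^1` maps the first to a multiple of the second and kills the
second. -/
theorem IsInduced.mem_iff_of_level_eq (hw : IsInduced p w Ψ) {m : Fin n → ℕ} (hm : level m = p)
    {v : W} (hv : v ∈ weightSpace W (lam p m)) :
    v ∈ (Fock.negative n).comap Ψ ↔ ι n (e n 1 0 0) • v = 0 := by
  have h11 : (1 : ZMod 2) + 1 = 0 := by decide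
  have h10 : (1 : ZMod 2) ≠ 0 := by decide
  have happ : ∀ k l, (ι n (e n 1 0 0) • Ψ v) k l =
      k 0 * (if l 0 = 0 then Ψ v (k - Pi.single 0 1) (l + Pi.single 0 1) else 0) +
      if l 0 = 1 then Ψ v (k + Pi.single 0 1) (l + Pi.single 0 1) else 0 := by
    intro k l
    rw [Fock.e_one_smul, Fock.add_apply, Fock.xOp_apply, Fock.flip_apply, Fock.flip_apply,
      Fock.dOp_apply]
    simp [Fock.raiseCoeff, Fock.lowerCoeff, Fock.jw_zero]
  constructor
  · intro h
    refine hw.injective ?_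
    rw [map_smul, map_zero]
    ext k l
    have hwt : ι n (e n 1 0 0) • v ∈ weightSpace W (lam p m) := by
      simpa using e_smul_mem_weightSpace 1 0 0 hv
    by_contra hne
    rw [← map_smul] at hne
    have h1 := (IsInduced.weight_of_apply_ne_zero hwt hne).1
    rw [map_smul, happ] at hne
    refine hne ?_
    rcases zmod_two_cases (l 0) with h0 | h0
    · rw [h0, ZMod.val_zero] at h1
      have : k 0 = 0 := by omega
      simp [h0, this]
    · rw [h0, show (1 : ZMod 2).val = 1 from rfl] at h1
      rw [if_neg (h0 ▸ h10), if_pos h0, mul_zero, zero_add]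
      exact h _ _ (by simp; omega)
  · intro h k l hk
    by_contra hne
    have h1 := (IsInduced.weight_of_apply_ne_zero hv hne).1
    have h2 := congrArg Ψ h
    rw [map_smul, map_zero] at h2
    have h3 := happ (k - Pi.single 0 1) (l + Pi.single 0 1)
    have h4 : k 0 = 0 := by omega
    have h5 : l 0 = 0 := by
      rw [← ZMod.val_eq_zero]; omega
    have h6 : l + Pi.single 0 1 + Pi.single 0 1 = l := by
      rw [add_assoc, ← Pi.single_add, h11, Pi.single_zero, add_zero]
    rw [h2, sub_add_cancel, h6] at h3
    simp [h5] at h3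
    exact hne h3.symm

end induced

/-! ### Level `p` -/

theorem finrank_map_add_finrank_ker_inf {V V' : Type*} [AddCommGroup V] [Module ℂ V]
    [AddCommGroup V'] [Module ℂ V'] (f : V →ₗ[ℂ] V') (S : Submodule ℂ V) [Module.Finite ℂ S] :
    Module.finrank ℂ (S.map f) + Module.finrank ℂ (LinearMap.ker f ⊓ S : Submodule ℂ V) =
      Module.finrank ℂ S := by
  have h := (f.domRestrict S).finrank_range_add_finrank_ker
  rw [LinearMap.range_domRestrict] at h
  rw [← h, inf_comm, ← Submodule.map_comap_subtype, Submodule.finrank_map_subtype_eq]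
  rfl

section induced

variable {p : ℕ} {W : Type*} [AddCommGroup W] [Module ℂ W] [Module (U n) W]
  [IsScalarTower ℂ (U n) W] {w : W} {Ψ : W →ₗ[U n] Fock n}

/-- The vector `X(p; k, l)` is obtained from `|p; k, l⟩` by applying `e_{00}^1`. -/
theorem IsInduced.e_one_smul_creation (hw : IsInduced p w Ψ) (k l : Fin n → ℕ)
    (hl : ∀ i, l i ≤ 1) :
    ι n (e n 1 0 0) • creation k l • w =
      ((-1 : ℂ) ^ (∑ i, l i) * (Real.sqrt p : ℂ)) • creation k l • w
      - ∑ i, ((-1 : ℂ) ^ (∑ j ∈ Finset.Iic i, l j) * (l i : ℂ)) •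
          creation (Function.update k i (k i + 1)) (Function.update l i (l i - 1)) • w
      - ∑ i, ((-1 : ℂ) ^ (∑ j ∈ Finset.Iic i, l j) * (if l i = 0 then 1 else 0) * (k i : ℂ)) •
          creation (Function.update k i (k i - 1)) (Function.update l i (l i + 1)) • w := by
  have h10 : (1 : ZMod 2) ≠ 0 := by decide
  rw [smul_smul, creation, odd_mul_mon bPlus_fPlus_comm fPlus_anticomm e_one_mul_bPlus
    e_one_mul_fPlus k l hl]
  have hIic : ∀ i, (-1 : ℂ) ^ (∑ j ∈ Finset.Iic i, l j) =
      (∏ j ∈ Finset.Iio i, (-1 : ℂ) ^ l j) * (-1) ^ l i := by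
    intro i
    rw [← Finset.Iio_insert, Finset.sum_insert (by simp), pow_add, Finset.prod_pow_eq_pow_sum,
      mul_comm]
  have h1 : ∀ i, (-1 : ℂ) ^ (∑ j ∈ Finset.Iic i, l j) * (l i : ℂ) =
      -((∏ j ∈ Finset.Iio i, (-1 : ℂ) ^ l j) * l i) := by
    intro i
    have := hl i
    rw [hIic]
    rcases (show l i = 0 ∨ l i = 1 by omega) with h | h <;> simp [h]
  have h2 : ∀ i, (-1 : ℂ) ^ (∑ j ∈ Finset.Iic i, l j) * (if l i = 0 then 1 else 0) =
      (∏ j ∈ Finset.Iio i, (-1 : ℂ) ^ l j) * (if l i = 0 then 1 else 0) := by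
    intro i
    rw [hIic]
    split_ifs with h <;> simp [h]
  simp only [h1, h2, neg_smul, Finset.sum_neg_distrib, sub_neg_eq_add]
  rw [add_smul, sub_smul, Finset.sum_smul, Finset.sum_smul, smul_assoc, mul_smul,
    hw.e_zero_smul, if_neg h10, U_smul_comm, ← add_sub_assoc, Finset.prod_pow_eq_pow_sum,
    smul_smul]
  simp only [smul_assoc]

/-- The parity operator: the monomial vectors with label `l` get the sign `(-1)^{l_1+⋯+l_n}`. -/
def IsInduced.parity (hw : IsInduced p w Ψ) : W →ₗ[ℂ] W :=
  hw.basis.constr ℂ fun a => (-1 : ℂ) ^ (∑ i, a.1.2 i) • hw.basis a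

theorem IsInduced.parity_creation (hw : IsInduced p w Ψ) (k l : Fin n → ℕ) :
    hw.parity (creation k l • w) = (-1 : ℂ) ^ (∑ i, l i) • creation k l • w := by
  by_cases hl : ∀ i, l i ≤ 1
  · have h := hw.basis_apply ⟨(k, l), hl⟩
    dsimp only at h
    rw [← h, parity, Module.Basis.constr_basis]
  · push Not at hl
    obtain ⟨i, hi⟩ := hl
    rw [creation, mon_eq_zero fPlus_anticomm k l i hi]
    simp

theorem IsInduced.parity_mem_weightSpace (hw : IsInduced p w Ψ) {m : Fin n → ℕ} {v : W}
    (hv : v ∈ weightSpace W (lam p m)) : hw.parity v ∈ weightSpace W (lam p m) := by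
  rw [hw.weightSpace_lam] at hv ⊢
  induction hv using Submodule.span_induction with
  | zero => simp
  | add x y _ _ hx hy => rw [map_add]; exact add_mem hx hy
  | smul c x _ hx => rw [map_smul]; exact Submodule.smul_mem _ c hx
  | mem x hx =>
    obtain ⟨l, rfl⟩ := hx
    rw [Function.comp_apply, hw.basis_apply, hw.parity_creation, ← hw.basis_apply]
    exact Submodule.smul_mem _ _ (Submodule.subset_span ⟨l, rfl⟩)

/-- The parity operator is, up to the factor `2√p`, a contracting homotopy for `e_{00}^1`: the
diagonal term of `e_{00}^1` is `√p` times the parity, and the other terms change the parity. -/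
theorem IsInduced.parity_e_one_smul (hw : IsInduced p w Ψ) (v : W) :
    hw.parity (ι n (e n 1 0 0) • v) + ι n (e n 1 0 0) • hw.parity v =
      (2 * (Real.sqrt p : ℂ)) • v := by
  induction hw.basis.mem_span v using Submodule.span_induction with
  | zero => simp
  | add x y _ _ hx hy =>
    rw [smul_add, map_add, map_add, smul_add, add_add_add_comm, hx, hy, smul_add]
  | smul c x _ hx =>
    rw [U_smul_comm, hw.parity.map_smul, hw.parity.map_smul, U_smul_comm, ← smul_add, hx, smul_comm]
  | mem x hx =>
    obtain ⟨⟨⟨k, l⟩, hl⟩, rfl⟩ := hx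
    rw [hw.basis_apply]
    dsimp only at hl ⊢
    rw [hw.parity_creation, U_smul_comm, hw.e_one_smul_creation k l hl]
    simp only [map_sub, map_sum, map_smul, hw.parity_creation]
    have h1 : ∀ i, ((-1 : ℂ) ^ (∑ j ∈ Finset.Iic i, l j) * (l i : ℂ)) •
        (-1 : ℂ) ^ (∑ j, Function.update l i (l i - 1) j) •
          creation (Function.update k i (k i + 1)) (Function.update l i (l i - 1)) • w =
        -((-1 : ℂ) ^ (∑ j, l j) • ((-1 : ℂ) ^ (∑ j ∈ Finset.Iic i, l j) * (l i : ℂ)) •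
          creation (Function.update k i (k i + 1)) (Function.update l i (l i - 1)) • w) := by
      intro i
      by_cases hi : l i = 0
      · simp [hi]
      · have : ∑ j, l j = ∑ j, Function.update l i (l i - 1) j + 1 := by
          conv_lhs => rw [← update_sub_one_add_one l hi, sum_update_add_one]
        rw [this, pow_succ, mul_neg_one, neg_smul, neg_neg, smul_comm]
    have h2 : ∀ i, ((-1 : ℂ) ^ (∑ j ∈ Finset.Iic i, l j) * (if l i = 0 then 1 else 0) * (k i : ℂ)) •
        (-1 : ℂ) ^ (∑ j, Function.update l i (l i + 1) j) •
          creation (Function.update k i (k i - 1)) (Function.update l i (l i + 1)) • w =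
        -((-1 : ℂ) ^ (∑ j, l j) •
          ((-1 : ℂ) ^ (∑ j ∈ Finset.Iic i, l j) * (if l i = 0 then 1 else 0) * (k i : ℂ)) •
          creation (Function.update k i (k i - 1)) (Function.update l i (l i + 1)) • w) := by
      intro i
      rw [sum_update_add_one, pow_succ, mul_neg_one, neg_smul, smul_neg, smul_comm]
    simp only [h1, h2, Finset.sum_neg_distrib, ← Finset.smul_sum, smul_sub]
    have hs : (-1 : ℂ) ^ (∑ j, l j) * (-1 : ℂ) ^ (∑ j, l j) = 1 := by
      rw [← mul_pow]; simp
    set s : ℂ := (-1 : ℂ) ^ (∑ j, l j)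
    have h3 : (s * (Real.sqrt p : ℂ)) • s • creation k l • w =
        (Real.sqrt p : ℂ) • creation k l • w := by
      rw [smul_smul, mul_right_comm, hs, one_mul]
    have h4 : s • (s * (Real.sqrt p : ℂ)) • creation k l • w =
        (Real.sqrt p : ℂ) • creation k l • w := by
      rw [smul_smul, ← mul_assoc, hs, one_mul]
    rw [h3, h4, two_mul, add_smul]
    abel

/-- The action of `e_{00}^1` as a linear map. -/
def oddEnd (n : ℕ) (W : Type*) [AddCommGroup W] [Module ℂ W] [Module (U n) W]
    [IsScalarTower ℂ (U n) W] : W →ₗ[ℂ] W where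
  toFun v := ι n (e n 1 0 0) • v
  map_add' := smul_add _
  map_smul' c v := U_smul_comm _ c v

theorem oddEnd_apply (v : W) : oddEnd n W v = ι n (e n 1 0 0) • v := rfl

/-- The square of `e_{00}^1` is `e_{00}^0`, which acts as `p - level m` on the weight `λ_m`. -/
theorem oddEnd_oddEnd (v : W) : oddEnd n W (oddEnd n W v) = ι n (e n 0 0 0) • v := by
  have h11 : (1 : ZMod 2) + 1 = 0 := by decide
  have h := e_smul_e_smul (n := n) 1 1 0 0 0 0 v
  simp only [if_true] at h
  rw [sgn_one_one, h11, neg_one_smul, neg_one_smul, sub_neg_eq_add,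
    eq_neg_add_iff_add_eq, ← two_smul ℂ, ← two_smul ℂ] at h
  exact smul_right_injective W (two_ne_zero (α := ℂ)) h

/-- At level `p`, where `e_{00}^1` has square zero, it is exact. -/
theorem IsInduced.map_oddEnd_weightSpace (hw : IsInduced p w Ψ) (hp : 0 < p) {m : Fin n → ℕ}
    (hm : level m = p) : (weightSpace W (lam p m)).map (oddEnd n W) =
      LinearMap.ker (oddEnd n W) ⊓ weightSpace W (lam p m) := by
  apply le_antisymm
  · rintro _ ⟨v, hv, rfl⟩
    refine ⟨?_, ?_⟩
    · rw [SetLike.mem_coe, LinearMap.mem_ker, oddEnd_oddEnd, hv 0, ← hm]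
      simp [lam, level]
    · rw [oddEnd_apply]
      simpa using e_smul_mem_weightSpace 1 0 0 hv
  · rintro v ⟨hv0, hv⟩
    have h := hw.parity_e_one_smul v
    rw [SetLike.mem_coe, LinearMap.mem_ker, oddEnd_apply] at hv0
    rw [hv0, map_zero, zero_add] at h
    have hs : (2 * (Real.sqrt p : ℂ)) ≠ 0 := by
      refine mul_ne_zero two_ne_zero (Complex.ofReal_ne_zero.2 ?_)
      exact Real.sqrt_ne_zero'.2 (Nat.cast_pos.2 hp)
    refine ⟨(2 * (Real.sqrt p : ℂ))⁻¹ • hw.parity v,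
      Submodule.smul_mem _ _ (hw.parity_mem_weightSpace hv), ?_⟩
    rw [map_smul, oddEnd_apply, h, smul_smul, inv_mul_cancel₀ hs, one_smul]

theorem IsInduced.inf_weightSpace_of_level_eq (hw : IsInduced p w Ψ) {m : Fin n → ℕ}
    (hm : level m = p) :
    ((Fock.negative n).comap Ψ).restrictScalars ℂ ⊓ weightSpace W (lam p m) =
      LinearMap.ker (oddEnd n W) ⊓ weightSpace W (lam p m) := by
  ext v
  simp only [Submodule.mem_inf, Submodule.restrictScalars_mem, LinearMap.mem_ker, oddEnd_apply]
  exact and_congr_left fun hv => hw.mem_iff_of_level_eq hm hv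

theorem IsInduced.two_mul_finrank (hw : IsInduced p w Ψ) (hp : 0 < p) {m : Fin n → ℕ}
    (hm : level m = p) :
    2 * Module.finrank ℂ (((Fock.negative n).comap Ψ).restrictScalars ℂ ⊓
      weightSpace W (lam p m) : Submodule ℂ W) = Module.finrank ℂ (weightSpace W (lam p m)) := by
  have := hw.finite_weightSpace m
  have h := finrank_map_add_finrank_ker_inf (oddEnd n W) (weightSpace W (lam p m))
  rw [hw.map_oddEnd_weightSpace hp hm] at h
  rw [hw.inf_weightSpace_of_level_eq hm, two_mul, h]

theorem IsInduced.span_oddEnd_creation (hw : IsInduced p w Ψ) (hp : 0 < p) {m : Fin n → ℕ}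
    (hm : level m = p) :
    Submodule.span ℂ {v : W | ∃ k l : Fin n → ℕ, (∀ i, l i ≤ 1) ∧ (∀ i, k i + l i = m i) ∧
      v = oddEnd n W (creation k l • w)} =
      ((Fock.negative n).comap Ψ).restrictScalars ℂ ⊓ weightSpace W (lam p m) := by
  rw [hw.inf_weightSpace_of_level_eq hm, ← hw.map_oddEnd_weightSpace hp hm,
    hw.weightSpace_eq_span, Submodule.map_span]
  congr 1
  ext v
  constructor
  · rintro ⟨k, l, hl, hkl, rfl⟩
    exact ⟨_, ⟨⟨(k, l), hl⟩, congrArg (lam p) (funext hkl), hw.basis_apply _⟩, rfl⟩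
  · rintro ⟨_, ⟨a, ha, rfl⟩, rfl⟩
    exact ⟨a.1.1, a.1.2, a.2, congrFun (lam_injective p ha), by rw [hw.basis_apply]⟩

/-! ### The quotient by the maximal submodule -/

section quotient

variable {V' : Type*} [AddCommGroup V'] [Module ℂ V'] [Module (U n) V'] [IsScalarTower ℂ (U n) V']
  (π : W →ₗ[U n] V')

theorem map_weightSpace_le (μ : Fin (n + 1) → ℂ) {v : W} (hv : v ∈ weightSpace W μ) :
    π v ∈ weightSpace V' μ := by
  intro i
  rw [← map_smul, hv i, LinearMap.map_smul_of_tower]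

/-- Weight spaces of a quotient are the images of the weight spaces. -/
theorem IsInduced.map_weightSpace (hw : IsInduced p w Ψ) (hπ : Function.Surjective π)
    (μ : Fin (n + 1) → ℂ) :
    (weightSpace W μ).map (π.restrictScalars ℂ) = weightSpace V' μ := by
  apply le_antisymm
  · rintro _ ⟨v, hv, rfl⟩
    exact map_weightSpace_le π μ hv
  · intro v' hv'
    obtain ⟨v, rfl⟩ := hπ v'
    obtain ⟨s, f, hf, rfl⟩ := hw.exists_weight_decomposition v
    rw [map_sum]
    refine Submodule.sum_mem _ fun m hm => ?_
    by_cases hmu : lam p m = μ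
    · exact ⟨f m, hmu ▸ hf m, rfl⟩
    · obtain ⟨j, hj⟩ := Function.ne_iff.1 hmu
      have h1 : ∑ m ∈ s, (lam p m j - μ j) • f m ∈ LinearMap.ker π := by
        have h2 := hv' j
        rw [← map_smul, ← LinearMap.map_smul_of_tower, ← sub_eq_zero, ← map_sub, Finset.smul_sum,
          Finset.smul_sum, ← Finset.sum_sub_distrib] at h2
        rw [LinearMap.mem_ker, ← h2]
        congr 1
        exact Finset.sum_congr rfl fun m _ => by rw [hf m j, sub_smul]
      have h3 := weight_component_mem (LinearMap.ker π) (lam p) (lam_injective p) s _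
        (fun m _ => Submodule.smul_mem _ (lam p m j - μ j) (hf m)) h1 m hm
      rw [LinearMap.mem_ker, LinearMap.map_smul_of_tower] at h3
      have h4 : π (f m) = 0 := (smul_eq_zero_iff_right (sub_ne_zero.2 hj)).1 h3
      rw [h4]
      exact Submodule.zero_mem _

theorem IsInduced.iSup_weightSpace_quotient (hw : IsInduced p w Ψ) (hπ : Function.Surjective π) :
    ⨆ μ : Fin (n + 1) → ℂ, weightSpace V' μ = ⊤ := by
  rw [eq_top_iff]
  rintro v' -
  obtain ⟨v, rfl⟩ := hπ v'
  obtain ⟨s, f, hf, rfl⟩ := hw.exists_weight_decomposition v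
  rw [map_sum]
  exact Submodule.sum_mem _ fun m _ =>
    Submodule.mem_iSup_of_mem (lam p m) (map_weightSpace_le π _ (hf m))

theorem IsInduced.finrank_weightSpace_quotient_add (hw : IsInduced p w Ψ)
    (hπ : Function.Surjective π) (m : Fin n → ℕ) :
    Module.finrank ℂ (weightSpace V' (lam p m)) +
      Module.finrank ℂ ((LinearMap.ker π).restrictScalars ℂ ⊓ weightSpace W (lam p m) :
        Submodule ℂ W) = Module.finrank ℂ (weightSpace W (lam p m)) := by
  have := hw.finite_weightSpace m
  rw [← hw.map_weightSpace π hπ]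
  exact finrank_map_add_finrank_ker_inf (π.restrictScalars ℂ) (weightSpace W (lam p m))

variable {π}

theorem IsInduced.finrank_weightSpace_quotient (hw : IsInduced p w Ψ) (hp : 0 < p)
    (hπ : Function.Surjective π) (hker : LinearMap.ker π = (Fock.negative n).comap Ψ)
    (m : Fin n → ℕ) :
    Module.finrank ℂ (weightSpace V' (lam p m)) =
      if level m < p then 2 ^ numNonzero m
      else if level m = p then 2 ^ (numNonzero m - 1) else 0 := by
  have h := hw.finrank_weightSpace_quotient_add π hπ m
  rw [hker, hw.finrank_weightSpace] at h
  split_ifs with h1 h2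
  · have hbot : ((Fock.negative n).comap Ψ).restrictScalars ℂ ⊓ weightSpace W (lam p m) = ⊥ := by
      rw [eq_bot_iff]
      rintro v ⟨hv1, hv2⟩
      by_contra hv0
      exact hw.notMem_of_level_lt h1 hv2 hv0 hv1
    rwa [hbot, finrank_bot, add_zero] at h
  · have h3 := hw.two_mul_finrank hp h2
    rw [hw.finrank_weightSpace] at h3
    have h4 : numNonzero m ≠ 0 := by
      intro h0
      rw [numNonzero, Finset.card_eq_zero, Finset.filter_eq_empty_iff] at h0
      have : level m = 0 := Finset.sum_eq_zero fun i hi => not_not.1 (h0 hi)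
      omega
    obtain ⟨r, hr⟩ := Nat.exists_eq_succ_of_ne_zero h4
    rw [hr, Nat.succ_eq_add_one, pow_succ] at h h3
    rw [hr, Nat.succ_eq_add_one, Nat.add_sub_cancel]
    omega
  · have htop : ((Fock.negative n).comap Ψ).restrictScalars ℂ ⊓ weightSpace W (lam p m) =
        weightSpace W (lam p m) :=
      inf_eq_right.2 fun v hv => IsInduced.mem_of_lt_level (by omega) hv
    rw [htop, hw.finrank_weightSpace] at h
    omega

theorem IsInduced.finite_quotient (hw : IsInduced p w Ψ)
    (hπ : Function.Surjective π) (hker : LinearMap.ker π = (Fock.negative n).comap Ψ) :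
    Module.Finite ℂ V' := by
  set S : Set (Idx n) := {a | level (a.1.1 + a.1.2) ≤ p} with hS
  have hfin : S.Finite := by
    refine Set.Finite.subset (((Set.finite_Iic (fun _ : Fin n => p)).prod
      (Set.finite_Iic (fun _ : Fin n => 1))).preimage Subtype.val_injective.injOn) ?_
    intro a ha
    refine ⟨fun i => ?_, a.2⟩
    have h1 : a.1.1 i + a.1.2 i ≤ level (a.1.1 + a.1.2) :=
      Finset.single_le_sum (f := a.1.1 + a.1.2) (fun _ _ => Nat.zero_le _) (Finset.mem_univ i)
    have h2 : level (a.1.1 + a.1.2) ≤ p := ha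
    dsimp only
    omega
  refine Module.finite_def.2 (Submodule.fg_def.2 ⟨(fun a => π (hw.basis a)) '' S,
    hfin.image _, ?_⟩)
  rw [eq_top_iff]
  rintro v' -
  obtain ⟨v, rfl⟩ := hπ v'
  induction hw.basis.mem_span v using Submodule.span_induction with
  | zero => simp
  | add x y _ _ hx hy => rw [map_add]; exact add_mem hx hy
  | smul c x _ hx => rw [LinearMap.map_smul_of_tower]; exact Submodule.smul_mem _ c hx
  | mem x hx =>
    obtain ⟨a, rfl⟩ := hx
    by_cases ha : a ∈ S
    · exact Submodule.subset_span ⟨a, ha, rfl⟩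
    · have h0 : hw.basis a ∈ LinearMap.ker π := by
        rw [hker, hw.basis_apply]
        exact IsInduced.mem_of_lt_level (not_le.1 ha) (hw.creation_mem_weightSpace _ _)
      rw [LinearMap.mem_ker.1 h0]
      exact Submodule.zero_mem _

end quotient

end induced

end QFock

end

open QFock in
theorem proposition4 (n p : ℕ) (hp : 0 < p) :
    -- `M_p` is the largest submodule different from the whole module
    IsGreatest {N : Submodule (U n) (Vbar n p) | N ≠ ⊤} (M n p) ∧
    -- the weights are exactly the `λ_m`, and `d_m = 2 ^ r`
    (∀ μ : Fin (n + 1) → ℂ, weightSpace (Vbar n p) μ ≠ ⊥ ↔ ∃ m : Fin n → ℕ, μ = lam p m) ∧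
    (∀ m : Fin n → ℕ,
      Module.finrank ℂ (weightSpace (Vbar n p) (lam p m)) = 2 ^ numNonzero m) ∧
    -- `M_p` is the sum of its weight spaces
    (⨆ m : Fin n → ℕ, MWeight n p (lam p m)) = (M n p).restrictScalars ℂ ∧
    -- level greater than `p`
    (∀ m : Fin n → ℕ, p < level m → ∀ v ∈ weightSpace (Vbar n p) (lam p m), v ∈ M n p) ∧
    -- level less than `p`
    (∀ m : Fin n → ℕ, level m < p →
      ∀ v ∈ weightSpace (Vbar n p) (lam p m), v ≠ 0 → v ∉ M n p) ∧
    -- level equal to `p`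
    (∀ m : Fin n → ℕ, level m = p →
      2 * Module.finrank ℂ (MWeight n p (lam p m)) =
          Module.finrank ℂ (weightSpace (Vbar n p) (lam p m)) ∧
      2 * Module.finrank ℂ (weightSpace (V n p) (lam p m)) =
          Module.finrank ℂ (weightSpace (Vbar n p) (lam p m)) ∧
      Submodule.span ℂ
          {w : Vbar n p | ∃ k l : Fin n → ℕ,
            (∀ i, l i ≤ 1) ∧ (∀ i, k i + l i = m i) ∧ w = X p k l} =
        MWeight n p (lam p m)) ∧
    -- `V_p` is finite-dimensional, and its weight multiplicities are as follows
    Module.Finite ℂ (V n p) ∧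
    (⨆ μ : Fin (n + 1) → ℂ, weightSpace (V n p) μ) = ⊤ ∧
    (∀ m : Fin n → ℕ,
      Module.finrank ℂ (weightSpace (V n p) (lam p m)) =
        if level m < p then 2 ^ numNonzero m
        else if level m = p then 2 ^ (numNonzero m - 1) else 0) ∧
    (∀ μ : Fin (n + 1) → ℂ, (¬ ∃ m : Fin n → ℕ, μ = lam p m) →
      weightSpace (V n p) μ = ⊥) := by
  have hw := isInduced_Vbar (n := n) p
  have hM : M n p = (Fock.negative n).comap (Fock.ofVbar n p) := hw.sSup_eq hp
  have hMW : ∀ μ, MWeight n p μ =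
      ((Fock.negative n).comap (Fock.ofVbar n p)).restrictScalars ℂ ⊓
        weightSpace (Vbar n p) μ := fun μ => by rw [← hM]; rfl
  have hπ : Function.Surjective (M n p).mkQ := Submodule.mkQ_surjective _
  have hker : LinearMap.ker (M n p).mkQ = (Fock.negative n).comap (Fock.ofVbar n p) := by
    rw [Submodule.ker_mkQ, hM]
  refine ⟨⟨?_, fun N hN => le_sSup hN⟩, hw.weightSpace_ne_bot_iff, hw.finrank_weightSpace,
    hw.iSup_inf_weightSpace (M n p), ?_, ?_, ?_, hw.finite_quotient hπ hker,
    hw.iSup_weightSpace_quotient _ hπ, hw.finrank_weightSpace_quotient hp hπ hker, ?_⟩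
  · rw [Set.mem_ofPred_eq, hM]
    exact hw.comap_negative_ne_top hp
  · intro m hm v hv
    rw [hM]
    exact IsInduced.mem_of_lt_level hm hv
  · intro m hm v hv hv0
    rw [hM]
    exact hw.notMem_of_level_lt hm hv hv0
  · intro m hm
    have h1 := hw.two_mul_finrank hp hm
    have h2 : Module.finrank ℂ (weightSpace (V n p) (lam p m)) + _ =
        Module.finrank ℂ (weightSpace (Vbar n p) (lam p m)) :=
      hw.finrank_weightSpace_quotient_add (M n p).mkQ hπ m
    rw [hker] at h2
    refine ⟨?_, by omega, ?_⟩
    · rw [hMW]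
      exact h1
    · rw [hMW, ← hw.span_oddEnd_creation hp hm]
      congr 1
      ext v
      have hX : ∀ k l : Fin n → ℕ, (∀ i, l i ≤ 1) →
          oddEnd n (Vbar n p) (creation k l • vac n p) = X p k l :=
        fun k l hl => hw.e_one_smul_creation k l hl
      constructor
      · rintro ⟨k, l, hl, hkl, rfl⟩
        exact ⟨k, l, hl, hkl, (hX k l hl).symm⟩
      · rintro ⟨k, l, hl, hkl, rfl⟩
        exact ⟨k, l, hl, hkl, hX k l hl⟩
  · intro μ hμ
    rw [← hw.map_weightSpace _ hπ, not_not.1 (mt (hw.weightSpace_ne_bot_iff μ).1 hμ),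
      Submodule.map_bot]
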